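/- Let $k$ be an infinite field, $n, a\ge 0$ integers, $X\hookrightarrow\mathbb{P}^n_k$ a (locally closed) subscheme and $Z\hookrightarrow X$ a (locally closed) subscheme of $X$. Let $\overline{Z}$ be the scheme-theoretic closure of $Z$ in $\mathbb{P}^n_k$, with ideal sheaf $\mathcal{I}_{\overline{Z}}\subset\mathcal{O}_{\mathbb{P}^n_k}$. Recall that a scheme $Y$ is an $R_a$-scheme if $\mathcal{O}_{Y,y}$ is a regular local ring for every $y\in Y$ with $\dim\mathcal{O}_{Y,y}\le a$, and that $\operatorname{codim}_X(Z)=\inf_{z\in Z}\dim\mathcal{O}_{X,z}$ ($=\infty$ if $Z=\emptyset$). Assume that $X$ is an $R_a$-scheme and that $\operatorname{codim}_X(Z)>a+1$. Then a general hypersurface $H\hookrightarrow\mathbb{P}^n_k$ containing $\overline{Z}$ satisfies that $X\cap H$ is an $R_a$-scheme. That is, there is an integer $d_0$ such that for every $d\ge d_0$ there is a nonempty open subscheme $\mathcal{U}$ of the projective space $|H^0(\mathbb{P}^n_k,\mathcal{I}_{\overline{Z}}(d))|$ of lines in $H^0(\mathbb{P}^n_k,\mathcal{I}_{\overline{Z}}(d))$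 such that for every $H\in\mathcal{U}(k)$, regarded as a hypersurface of degree $d$ in $\mathbb{P}^n_k$ containing $\overline{Z}$, the scheme-theoretic intersection $X\cap H = X\times_{\mathbb{P}^n_k}H$ is an $R_a$-scheme. -/

import Mathlib

open AlgebraicGeometry CategoryTheory CategoryTheory.Limits

universe u

attribute [local instance] MvPolynomial.gradedAlgebra

noncomputable section

namespace RaBertini

/-- The projective space `Proj k[x_i : i ∈ ι]` with homogeneous coordinates indexed by `ι`. -/
abbrev ProjSpace (ι : Type) (k : Type u) [Field k] : Scheme.{u} :=
  Proj (MvPolynomial.homogeneousSubmodule ι k)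

/-- The projective space `ℙⁿ_k = Proj k[x_0, …, x_n]`. -/
abbrev PP (n : ℕ) (k : Type u) [Field k] : Scheme.{u} :=
  ProjSpace (Fin (n + 1)) k

/-- The `k`-rational point `[c]` of projective space with homogeneous coordinates `c ≠ 0`: the
homogeneous prime ideal generated by the homogeneous polynomials that vanish at `c`. -/
def rationalPoint {ι : Type} {k : Type u} [Field k] (c : ι → k) (hc : c ≠ 0) :
    ProjSpace ι k where
  asHomogeneousIdeal := Ideal.homogeneousCore (MvPolynomial.homogeneousSubmodule ι k)
    (RingHom.ker (MvPolynomial.eval c))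
  isPrime := Ideal.IsPrime.homogeneousCore (RingHom.ker_isPrime _)
  not_irrelevant_le := by
    intro h
    obtain ⟨i, hi⟩ := Function.ne_iff.mp hc
    have hX : MvPolynomial.X i ∈ MvPolynomial.homogeneousSubmodule ι k 1 :=
      MvPolynomial.isHomogeneous_X k i
    have h1 : (MvPolynomial.X i : MvPolynomial ι k) ∈
        HomogeneousIdeal.irrelevant (MvPolynomial.homogeneousSubmodule ι k) := by
      rw [HomogeneousIdeal.mem_irrelevant_iff, GradedRing.proj_apply,
        DirectSum.decompose_of_mem_ne _ hX one_ne_zero]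
    have h2 := Ideal.toIdeal_homogeneousCore_le _ _ (h h1)
    rw [RingHom.mem_ker, MvPolynomial.eval_X] at h2
    exact hi h2

/-- A homogeneous polynomial vanishes at the point `[c]` exactly when it vanishes at `c`. -/
lemma mem_rationalPoint_iff {ι : Type} {k : Type u} [Field k] (c : ι → k) (hc : c ≠ 0)
    (d : ℕ) (F : MvPolynomial ι k) (hF : F.IsHomogeneous d) :
    F ∈ (rationalPoint c hc).asHomogeneousIdeal ↔ MvPolynomial.eval c F = 0 := by
  constructor
  · intro h
    exact Ideal.toIdeal_homogeneousCore_le _ _ h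
  · intro h
    exact Ideal.mem_homogeneousCore_of_homogeneous_of_mem ⟨d, hF⟩ h

section Sections

variable {k : Type u} [Field k] {n : ℕ}

/-- The standard chart `D₊(x_i)` of `ℙⁿ`, as an affine open. -/
def chart (k : Type u) [Field k] {n : ℕ} (i : Fin (n + 1)) : (PP n k).affineOpens :=
  ⟨Proj.basicOpen _ (MvPolynomial.X i : MvPolynomial (Fin (n + 1)) k),
    Proj.isAffineOpen_basicOpen _ _ (m := 1) (MvPolynomial.isHomogeneous_X k i) one_pos⟩

/-- The fraction `s / x_i ^ d` in the degree-zero part of `k[x]_{x_i}`, for `s` of degree `d`. -/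
def dehomAway {d : ℕ} (s : MvPolynomial.homogeneousSubmodule (Fin (n + 1)) k d)
    (i : Fin (n + 1)) :
    HomogeneousLocalization.Away (MvPolynomial.homogeneousSubmodule (Fin (n + 1)) k)
      (MvPolynomial.X i) :=
  HomogeneousLocalization.Away.mk _ (d := 1) (MvPolynomial.isHomogeneous_X k i) d s.1
    (by rw [smul_eq_mul, mul_one]; exact s.2)

/-- The regular function `s / x_i ^ d` on `D₊(x_i)`: the section `s` of `𝒪(d)` in the
trivialization of `𝒪(d)` on `D₊(x_i)` by `x_i ^ d`. -/
def dehom {d : ℕ} (s : MvPolynomial.homogeneousSubmodule (Fin (n + 1)) k d)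
    (i : Fin (n + 1)) : Γ(PP n k, (chart k i).1) :=
  (Proj.awayToSection _ _).hom (dehomAway s i)

lemma val_dehomAway {d : ℕ} (s : MvPolynomial.homogeneousSubmodule (Fin (n + 1)) k d)
    (i : Fin (n + 1)) :
    (dehomAway s i).val = Localization.mk s.1
      (⟨MvPolynomial.X i ^ d, ⟨d, rfl⟩⟩ : Submonoid.powers (MvPolynomial.X i)) := rfl

lemma dehom_zero {d : ℕ} (i : Fin (n + 1)) :
    dehom (0 : MvPolynomial.homogeneousSubmodule (Fin (n + 1)) k d) i = 0 := by
  have : dehomAway (0 : MvPolynomial.homogeneousSubmodule (Fin (n + 1)) k d) i = 0 := by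
    apply HomogeneousLocalization.val_injective
    rw [val_dehomAway, HomogeneousLocalization.val_zero]
    exact Localization.mk_zero _
  rw [dehom, this, map_zero]
  rfl

lemma dehom_add {d : ℕ} (s t : MvPolynomial.homogeneousSubmodule (Fin (n + 1)) k d)
    (i : Fin (n + 1)) : dehom (s + t) i = dehom s i + dehom t i := by
  have : dehomAway (s + t) i = dehomAway s i + dehomAway t i := by
    apply HomogeneousLocalization.val_injective
    rw [HomogeneousLocalization.val_add, val_dehomAway, val_dehomAway, val_dehomAway,
      Localization.add_mk_self]
    rfl
  rw [dehom, this, map_add]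
  rfl

lemma dehom_smul {d : ℕ} (c : k) (s : MvPolynomial.homogeneousSubmodule (Fin (n + 1)) k d)
    (i : Fin (n + 1)) : ∃ r, dehom (c • s) i = r * dehom s i := by
  let c' : MvPolynomial.homogeneousSubmodule (Fin (n + 1)) k 0 :=
    ⟨MvPolynomial.C c, MvPolynomial.isHomogeneous_C _ c⟩
  have : dehomAway (c • s) i = dehomAway c' i * dehomAway s i := by
    apply HomogeneousLocalization.val_injective
    rw [HomogeneousLocalization.val_mul, val_dehomAway, val_dehomAway, val_dehomAway,
      Localization.mk_mul]
    congr 1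
    · simp [c', MvPolynomial.smul_eq_C_mul]
    · ext
      simp
  exact ⟨dehom c' i, by rw [dehom, this, map_mul]; rfl⟩

/-- `H⁰(ℙⁿ, I(d))` for an ideal sheaf `I` on `ℙⁿ`, as a subspace of
`H⁰(ℙⁿ, 𝒪(d)) = k[x_0, …, x_n]_d`: the forms `s` of degree `d` for which every
`s / x_i ^ d` lies in `I(D₊(x_i))`. -/
def globalSections (I : (PP n k).IdealSheafData) (d : ℕ) :
    Submodule k (MvPolynomial.homogeneousSubmodule (Fin (n + 1)) k d) where
  carrier := {s | ∀ i, dehom s i ∈ I.ideal (chart k i)}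
  zero_mem' i := by rw [dehom_zero]; exact zero_mem _
  add_mem' hs ht i := by rw [dehom_add]; exact add_mem (hs i) (ht i)
  smul_mem' c s hs i := by
    obtain ⟨r, hr⟩ := dehom_smul c s i
    rw [hr]
    exact Ideal.mul_mem_left _ _ (hs i)

instance (I : (PP n k).IdealSheafData) (d : ℕ) : Module.Finite k (globalSections I d) :=
  have : Module.Finite k (MvPolynomial.homogeneousSubmodule (Fin (n + 1)) k d) :=
    Module.Finite.iff_fg.mpr (MvPolynomial.homogeneousSubmodule_fg _ k d)
  inferInstance

instance (I : (PP n k).IdealSheafData) (d : ℕ) : Module.Free k (globalSections I d) :=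
  Module.Free.of_divisionRing k (globalSections I d)

/-- The ideal sheaf of the hypersurface `{s = 0}`: the smallest ideal sheaf `J` on `ℙⁿ` such that
`s` is a section of `J(d)`. -/
def hypersurfaceIdeal {d : ℕ} (s : MvPolynomial.homogeneousSubmodule (Fin (n + 1)) k d) :
    (PP n k).IdealSheafData :=
  sInf {J | s ∈ globalSections J d}

/-- The intersection `X ∩ H` of a subscheme `i : X ⟶ ℙⁿ` with the hypersurface `H = {s = 0}`. -/
def interHypersurface {X : Scheme.{u}} (i : X ⟶ PP n k) {d : ℕ}
    (s : MvPolynomial.homogeneousSubmodule (Fin (n + 1)) k d) : Scheme.{u} :=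
  pullback i (hypersurfaceIdeal s).subschemeι

/-- The projective space `|H⁰(ℙⁿ, I(d))|` of lines in `H⁰(ℙⁿ, I(d))`, with the homogeneous
coordinates given by a basis of `H⁰(ℙⁿ, I(d))`. It is empty if there are no nonzero sections. -/
abbrev linearSystem (I : (PP n k).IdealSheafData) (d : ℕ) : Scheme.{u} :=
  ProjSpace (Fin (Module.finrank k (globalSections I d))) k

/-- The `k`-rational point of `|H⁰(ℙⁿ, I(d))|` given by the line through a nonzero section. -/
def linearSystemPoint {I : (PP n k).IdealSheafData} {d : ℕ} (s : globalSections I d)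
    (hs : s ≠ 0) : linearSystem I d :=
  rationalPoint (⇑((Module.finBasis k (globalSections I d)).repr s))
    (by simpa using hs)

/-- A general hypersurface `H ⊆ ℙⁿ` containing the closed subscheme with ideal sheaf `I`
satisfies the property `P` for the subscheme `i : X ⟶ ℙⁿ`: for all `d ≫ 0` there is a nonempty
open `U ⊆ |H⁰(ℙⁿ, I(d))|` such that `X ∩ H` has `P` for every `H ∈ U(k)`. -/
def GeneralHypersurface (I : (PP n k).IdealSheafData) {X : Scheme.{u}} (i : X ⟶ PP n k)
    (P : Scheme.{u} → Prop) : Prop :=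
  ∃ d₀ : ℕ, ∀ d : ℕ, d₀ ≤ d → ∃ U : (linearSystem I d).Opens,
    (U : Set (linearSystem I d)).Nonempty ∧
    ∀ (s : globalSections I d) (hs : s ≠ 0), linearSystemPoint s hs ∈ U →
      P (interHypersurface i s.1)

end Sections

/-- `X` is an `R_a`-scheme: the local ring at every point of codimension at most `a` is regular. -/
def IsRa (a : ℕ) (X : Scheme.{u}) : Prop :=
  ∀ x : X, ringKrullDim (X.presheaf.stalk x) ≤ a → IsRegularLocalRing (X.presheaf.stalk x)

/-- The codimension in `X` of a subscheme `j : Z ⟶ X`, i.e. the infimum over the points `z` of `Z`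
of the codimension of `z` in `X` (the supremum of the lengths of chains of generizations of `z` in
`X`, equal to `dim 𝒪_{X,z}`). It is `⊤` if `Z` is empty. -/
def codim {Z X : Scheme.{u}} (j : Z ⟶ X) : ℕ∞ :=
  ⨅ z : Z, Order.coheight (j z)

end RaBertini

end

/-!
Away from `Z̄` some section `g` of `I(e)` is locally a unit `u` on an affine open `Spec A ⊆ X` in a
chart `D₊(x_m)`, and for `d > e` the sections `g * x_m ^ (d - e - 1) * x_j` of `I(d)` become
`u * (x_j / x_m)`, which separate 1-jets because the `x_j / x_m` generate the coordinate ring of the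
chart. Let `K` be the residue field at a prime `p`. The condition that a member `∑ j, v j * s j` of
the system and its derivatives vanish at the generic point of `p` consists of `1 + dim Ω[A/k] ⊗ K`
linear forms in `v`, independent over `K` by the separation of jets. Since
`trdeg K ≤ dim Ω[A/k] ⊗ K` in every characteristic, the `v` for which all these forms vanish
somewhere on a neighbourhood of that point in `V(p)` lie in a proper closed subset defined over `k`.
Noetherian induction gives that the local equation of a general member lies outside `𝔪 ^ 2`
everywhere, so that the member cuts a regular local ring in a regular local ring.

A point of `X ∩ H` whose local ring there has dimension at most `a` has a local ring of dimension at
most `a + 1` on `X`. This is regular apart from finitely many points of codimension `a + 1`, because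
the regular locus of `X` is open, and a general member avoids those points. Finally a point of
`X ∩ H` over `Z̄` is a specialization of a point of `Z`, so its local ring on `X` has dimension
greater than `a + 1` and the one on `X ∩ H` has dimension greater than `a`.

The openness of the regular locus is needed over imperfect `k` as well. It is proved by the Jacobian
criterion on affine space with derivations over a perfect subfield, over which every field extension
is formally smooth.
-/

namespace RaBertini

section Derivation

open IsLocalRing Algebra TensorProduct

variable {F P : Type*} [CommRing F] [CommRing P] [Algebra F P]

lemma derivation_eq_zero_of_mem_sq {M : Type*} [AddCommGroup M] [Module P M] [Module F M]
    (D : Derivation F P M) {I : Ideal P} (hI : ∀ a ∈ I, ∀ m : M, a • m = 0) {x : P}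
    (hx : x ∈ I ^ 2) : D x = 0 := by
  rw [sq] at hx
  refine Submodule.mul_induction_on hx (fun a ha b hb => ?_) fun a b ha hb => ?_
  · rw [Derivation.leibniz, hI a ha, hI b hb, add_zero]
  · rw [map_add, ha, hb, add_zero]

lemma exists_derivation_extending_of_formallyEtale {S M : Type*} [CommRing S] [Algebra F S]
    [Algebra P S] [IsScalarTower F P S] [FormallyEtale P S] [AddCommGroup M] [Module F M]
    [Module P M] [Module S M] [IsScalarTower P S M] [IsScalarTower F P M] [IsScalarTower F S M]
    (D : Derivation F P M) :
    ∃ D' : Derivation F S M, ∀ x, D' (algebraMap P S x) = D x := by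
  refine ⟨(D.liftKaehlerDifferential.liftBaseChange S ∘ₗ
    (KaehlerDifferential.tensorKaehlerEquivOfFormallyEtale F P S).symm.toLinearMap).compDer
      (KaehlerDifferential.D F S), fun x => ?_⟩
  change D.liftKaehlerDifferential.liftBaseChange S
    ((KaehlerDifferential.tensorKaehlerEquivOfFormallyEtale F P S).symm
      (KaehlerDifferential.D F S (algebraMap P S x))) = _
  rw [KaehlerDifferential.tensorKaehlerEquivOfFormallyEtale_symm_D_algebraMap,
    LinearMap.liftBaseChange_tmul, one_smul, Derivation.liftKaehlerDifferential_comp_D]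

lemma exists_derivation_eq_of_formallySmooth {A M : Type*} [CommRing A] [Algebra F A]
    [Algebra P A] [IsScalarTower F P A] [FormallySmooth F P] [FormallySmooth F A]
    (hA : Function.Surjective (algebraMap P A)) [AddCommGroup M] [Module F M] [Module P M]
    [IsScalarTower F P M] {I : Ideal P} (hI : RingHom.ker (algebraMap P A) = I)
    (φ : I.Cotangent →ₗ[P] M) :
    ∃ D : Derivation F P M, ∀ x : I, D x = φ (I.toCotangent x) := by
  subst hI
  obtain ⟨l, hl⟩ := (FormallySmooth.iff_split_injection (R := F) hA).mp inferInstance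
  refine ⟨(φ ∘ₗ l ∘ₗ TensorProduct.mk P A Ω[P⁄F] 1).compDer (KaehlerDifferential.D F P),
    fun x => congrArg φ ?_⟩
  exact LinearMap.congr_fun hl (Ideal.toCotangent _ x)

lemma linearIndependent_toCotangent_of_derivation [IsLocalRing P] {ι : Type*} [Finite ι]
    {f : ι → P} (hf : ∀ j, f j ∈ maximalIdeal P) (D : ι → Derivation F P (ResidueField P))
    (hD : ∀ i j, D i (f j) = 0 ↔ i ≠ j) :
    LinearIndependent (ResidueField P)
      (fun j => ((maximalIdeal P).toCotangent ⟨f j, hf j⟩ : CotangentSpace P)) := by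
  cases nonempty_fintype ι
  have hsmul (a : P) (ha : a ∈ maximalIdeal P) (m : ResidueField P) : a • m = 0 := by
    rw [Algebra.smul_def, ResidueField.algebraMap_eq, (residue_eq_zero_iff a).mpr ha, zero_mul]
  rw [Fintype.linearIndependent_iff]
  intro a ha i
  choose u hu using fun j => residue_surjective (a j)
  have hsq : ∑ j, u j • f j ∈ maximalIdeal P ^ 2 := by
    have hzero : (maximalIdeal P).toCotangent (∑ j, u j • ⟨f j, hf j⟩) = 0 := by
      rw [map_sum, ← ha]
      refine Finset.sum_congr rfl fun j _ => ?_
      rw [map_smul, ← hu]; rfl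
    simpa only [Ideal.toCotangent_eq_zero, AddSubmonoidClass.coe_finsetSum,
      SetLike.val_smul] using hzero
  have hDi := derivation_eq_zero_of_mem_sq (D i) hsmul hsq
  rw [map_sum, Finset.sum_eq_single i (fun j _ hj => by
      rw [smul_eq_mul, Derivation.leibniz, (hD i j).mpr hj.symm, smul_zero, zero_add,
        hsmul _ (hf j)]) (by simp), smul_eq_mul, Derivation.leibniz, hsmul _ (hf i), add_zero,
    Algebra.smul_def, mul_eq_zero, ResidueField.algebraMap_eq, hu] at hDi
  exact hDi.resolve_right fun h => (hD i i).mp h rfl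

lemma one_tmul_D_eq_zero_iff {K : Type*} [Field K] [Algebra F K] [Algebra P K]
    [IsScalarTower F P K] (x : P) :
    (1 : K) ⊗ₜ[P] KaehlerDifferential.D F P x = 0 ↔ ∀ D : Derivation F P K, D x = 0 := by
  constructor
  · intro h D
    simpa using congrArg (D.liftKaehlerDifferential.liftBaseChange K) h
  · intro h
    rw [← Module.forall_dual_apply_eq_zero_iff K]
    intro φ
    let ψ : Ω[P⁄F] →ₗ[P] K := φ.restrictScalars P ∘ₗ TensorProduct.mk P K _ 1
    exact h (ψ.compDer (KaehlerDifferential.D F P))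

lemma formallySmooth_iff_forall_mem_ker_sq [FormallySmooth F P] {K : Type*} [Field K]
    [Algebra F K] [Algebra P K] [IsScalarTower F P K] [Module.Projective K Ω[K⁄F]]
    (hK : Function.Surjective (algebraMap P K)) :
    FormallySmooth F K ↔ ∀ x ∈ RingHom.ker (algebraMap P K),
      (∀ D : Derivation F P K, D x = 0) → x ∈ RingHom.ker (algebraMap P K) ^ 2 := by
  rw [formallySmooth_iff, and_iff_right ‹_›,
    ← FormallySmooth.kerCotangentToTensor_injective_iff (P := P) hK, injective_iff_map_eq_zero,
    (Ideal.toCotangent_surjective _).forall, Subtype.forall]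
  simp only [KaehlerDifferential.kerCotangentToTensor_toCotangent, one_tmul_D_eq_zero_iff,
    Ideal.toCotangent_eq_zero]

end Derivation

section PerfectField

open Algebra MvPolynomial

lemma algebraMap_self_rename {F E L : Type*} [CommRing F] [CommRing E] [CommRing L]
    [Algebra F E] [Algebra F L] [Algebra E L] [IsScalarTower F E L] (z : MvPolynomial E F) :
    algebraMap (Generators.self F L).Ring L (rename (algebraMap E L) z) =
      algebraMap E L (algebraMap (Generators.self F E).Ring E z) := by
  simp only [Generators.algebraMap_apply, Generators.self_val, aeval_rename, Function.comp_def,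
    id_eq, ← aeval_algebraMap_apply]

lemma exists_derivation_self_rename {F E L : Type*} [Field F] [Field E] [Field L] [Algebra F E]
    [Algebra F L] [Algebra E L] [IsScalarTower F E L]
    (D : Derivation F (Generators.self F E).Ring E) :
    ∃ D' : Derivation F (Generators.self F L).Ring L,
      ∀ z, D' (rename (algebraMap E L) z) = algebraMap E L (D z) := by
  let := (Generators.self F L).algebra
  let D' : Derivation F (MvPolynomial L F) L :=
    mkDerivation F (Function.extend (algebraMap E L) (fun l => algebraMap E L (D (X l))) 0)
  have hsmul (p : MvPolynomial E F) (y : L) : rename (algebraMap E L) p • y =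
      algebraMap E L (algebraMap (Generators.self F E).Ring E p) * y := by
    rw [Algebra.smul_def, ← algebraMap_self_rename]
  refine ⟨D', fun z => ?_⟩
  induction z using MvPolynomial.induction_on with
  | C a => simp [← algebraMap_eq]
  | add p q hp hq => simp [hp, hq]
  | mul_X p l hp =>
    rw [map_mul, Derivation.leibniz, Derivation.leibniz, hsmul, hsmul, hp, rename_X,
      mkDerivation_X F _, (algebraMap E L).injective.extend_apply, map_add, Algebra.smul_def,
      Algebra.smul_def, map_mul, map_mul]

/-- A polynomial relation lives over a finitely generated subextension, which is separably
generated over a perfect field. -/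
lemma formallySmooth_of_perfectField (F L : Type*) [Field F] [Field L] [Algebra F L]
    [PerfectField F] : FormallySmooth F L := by
  rw [formallySmooth_iff_forall_mem_ker_sq (Generators.self F L).algebraMap_surjective]
  intro x hx hDx
  obtain ⟨s, q, rfl⟩ := exists_finset_rename x
  let E := IntermediateField.adjoin F (s : Set L)
  have : EssFiniteType F E := IntermediateField.essFiniteType_iff.mpr ⟨s, rfl⟩
  let j : s → E := fun l => ⟨l.1, IntermediateField.subset_adjoin F _ l.2⟩
  obtain ⟨z, hz⟩ : ∃ z : (Generators.self F E).Ring, rename (algebraMap E L) z =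
    rename Subtype.val q := ⟨rename j q, rename_rename _ _ _⟩
  rw [← hz] at hx hDx ⊢
  have hzE : z ∈ RingHom.ker (algebraMap (Generators.self F E).Ring E) ^ 2 := by
    refine (formallySmooth_iff_forall_mem_ker_sq (F := F)
      (Generators.self F E).algebraMap_surjective).mp inferInstance z ?_ fun D => ?_
    · rw [RingHom.mem_ker, algebraMap_self_rename] at hx
      exact (algebraMap E L).injective (hx.trans (map_zero _).symm)
    · obtain ⟨D', hD'⟩ := exists_derivation_self_rename (L := L) D
      exact (algebraMap E L).injective ((hD' z).symm.trans ((hDx D').trans (map_zero _).symm))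
  have hzL := Ideal.mem_map_of_mem (rename (R := F) (algebraMap E L)) hzE
  rw [Ideal.map_pow] at hzL
  refine Ideal.pow_right_mono (Ideal.map_le_iff_le_comap.mpr fun y hy => ?_) 2 hzL
  rw [Ideal.mem_comap, RingHom.mem_ker, algebraMap_self_rename, RingHom.mem_ker.mp hy, map_zero]

end PerfectField

section RegularQuotient

open IsLocalRing

variable {R : Type*} [CommRing R]

lemma span_range_toCotangent_eq_top_iff [IsLocalRing R] [IsNoetherianRing R] {ι : Type*}
    {g : ι → R} (hg : ∀ i, g i ∈ maximalIdeal R) :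
    Submodule.span (ResidueField R)
      (Set.range fun i => ((maximalIdeal R).toCotangent ⟨g i, hg i⟩ : CotangentSpace R)) = ⊤ ↔
    Ideal.span (Set.range g) = maximalIdeal R := by
  rw [Set.range_comp' (maximalIdeal R).toCotangent, CotangentSpace.span_image_eq_top_iff,
    ← (Submodule.map_injective_of_injective (Submodule.injective_subtype _)).eq_iff,
    Submodule.map_span, Submodule.map_top, Submodule.range_subtype, ← Set.range_comp]
  rfl

lemma sumExtend_inl {K V ι : Type*} [DivisionRing K] [AddCommGroup V] [Module K V] {v : ι → V}
    (hv : LinearIndependent K v) (i : ι) : Module.Basis.sumExtend hv (Sum.inl i) = v i := by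
  simp only [Module.Basis.sumExtend, Module.Basis.coe_reindex, Function.comp_apply,
    Module.Basis.extend_apply_self]
  rfl

lemma spanFinrank_maximalIdeal_quotient_add_card_le [IsLocalRing R] [IsNoetherianRing R]
    {ι : Type*} [Finite ι] {f : ι → R} [IsLocalRing (R ⧸ Ideal.span (Set.range f))]
    (hf : ∀ j, f j ∈ maximalIdeal R)
    (hli : LinearIndependent (ResidueField R)
      (fun j => ((maximalIdeal R).toCotangent ⟨f j, hf j⟩ : CotangentSpace R))) :
    (maximalIdeal (R ⧸ Ideal.span (Set.range f))).spanFinrank + Nat.card ι ≤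
      (maximalIdeal R).spanFinrank := by
  let b := Module.Basis.sumExtend hli
  have hb := Module.Finite.finite_basis b
  have : Finite (Module.Basis.sumExtendIndex hli) := Finite.sum_right ι
  choose g hg using fun i => (maximalIdeal R).toCotangent_surjective (b (Sum.inr i))
  have hmax : maximalIdeal R = Ideal.span (Set.range (Sum.elim f fun i => (g i : R))) := by
    refine ((span_range_toCotangent_eq_top_iff (Sum.rec hf fun i => (g i).2)).mp ?_).symm
    rw [← b.span_eq]
    congr 2
    funext i
    rcases i with j | i
    · exact (sumExtend_inl hli j).symm
    · exact hg i
  have hmax' : maximalIdeal (R ⧸ Ideal.span (Set.range f)) =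
      Ideal.span (Set.range fun i => Ideal.Quotient.mk _ (g i : R)) := by
    refine (map_maximalIdeal_of_surjective _ Ideal.Quotient.mk_surjective).symm.trans
      ((congrArg (Ideal.map _) hmax).trans ?_)
    rw [Set.Sum.elim_range, Ideal.span_union, Ideal.map_sup, Ideal.map_quotient_self, bot_sup_eq,
      Ideal.map_span, ← Set.range_comp]
    rfl
  rw [hmax', spanFinrank_maximalIdeal_eq_finrank_cotangentSpace,
    Module.finrank_eq_nat_card_basis b, Nat.card_sum, add_comm]
  gcongr
  exact (Submodule.spanFinrank_span_le_ncard_of_finite (Set.finite_range _)).trans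
    (Finite.card_range_le _)

lemma isRegularLocalRing_quotient_span [IsRegularLocalRing R] {ι : Type*} [Finite ι] {f : ι → R}
    (hf : ∀ j, f j ∈ maximalIdeal R)
    (hli : LinearIndependent (ResidueField R)
      (fun j => ((maximalIdeal R).toCotangent ⟨f j, hf j⟩ : CotangentSpace R))) :
    IsRegularLocalRing (R ⧸ Ideal.span (Set.range f)) := by
  have hle : Ideal.span (Set.range f) ≤ maximalIdeal R :=
    Ideal.span_le.mpr (Set.range_subset_iff.mpr hf)
  have : Nontrivial (R ⧸ Ideal.span (Set.range f)) :=
    Ideal.Quotient.nontrivial_iff.mpr (ne_top_of_le_ne_top Ideal.IsPrime.ne_top' hle)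
  have : IsLocalRing (R ⧸ Ideal.span (Set.range f)) :=
    .of_surjective' (Ideal.Quotient.mk _) Ideal.Quotient.mk_surjective
  refine IsRegularLocalRing.of_spanFinrank_maximalIdeal_le _
    (ENat.WithBot.add_le_add_natCast_right_iff (c := Nat.card ι).mp ?_)
  have hcard : (Set.range f).encard ≤ Nat.card ι := by
    rw [← (Set.finite_range f).cast_ncard_eq]
    exact_mod_cast Finite.card_range_le f
  calc _ ≤ ((maximalIdeal R).spanFinrank : WithBot ℕ∞) := by
        exact_mod_cast spanFinrank_maximalIdeal_quotient_add_card_le hf hli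
    _ = ringKrullDim R := (isRegularLocalRing_iff R).mp inferInstance
    _ ≤ ringKrullDim (R ⧸ Ideal.span (Set.range f)) + (Set.range f).encard :=
        ringKrullDim_le_ringKrullDim_quotient_add_encard _
          (by rwa [ringJacobson_eq_maximalIdeal, ← Ideal.span_le])
    _ ≤ _ := by gcongr; exact_mod_cast hcard

end RegularQuotient

section CommonDenominator

variable {P M : Type*} [CommRing P] (I : Ideal P) [I.IsPrime] [AddCommGroup M] [Module P M]

instance isLocalizedModule_quotient_residueField : IsLocalizedModule I.primeCompl
    (IsScalarTower.toAlgHom P (P ⧸ I) I.ResidueField).toLinearMap := by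
  have : (⊥ : Ideal (P ⧸ I)).LiesOver I := ⟨Ideal.mk_ker.symm⟩
  rw [isLocalizedModule_iff_isLocalization,
    Ideal.algebraMapSubmonoid_primeCompl_of_liesOver_surjective (P := ⊥) (p := I)
      Ideal.Quotient.mk_surjective, Ideal.primeCompl_bot]
  infer_instance

lemma exists_linearMap_quotient_of_finitePresentation [Module.FinitePresentation P M]
    (l : M →ₗ[P] I.ResidueField) :
    ∃ c ∉ I, ∃ l' : M →ₗ[P] P ⧸ I, ∀ x, algebraMap (P ⧸ I) I.ResidueField (l' x) = c • l x := by
  obtain ⟨l', c, h⟩ := Module.FinitePresentation.exists_lift_of_isLocalizedModule I.primeCompl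
    (IsScalarTower.toAlgHom P (P ⧸ I) I.ResidueField).toLinearMap l
  exact ⟨c, c.2, l', LinearMap.congr_fun h⟩

lemma exists_linearMap_quotient_of_projective [Module.Projective P M]
    (l : M →ₗ[P] I.ResidueField) {ι : Type*} [Finite ι] (v : ι → M) :
    ∃ c ∉ I, ∃ l' : M →ₗ[P] P ⧸ I,
      ∀ j, algebraMap (P ⧸ I) I.ResidueField (l' (v j)) = c • l (v j) := by
  classical
  cases nonempty_fintype ι
  obtain ⟨s, hs⟩ := Module.projective_def'.mp ‹Module.Projective P M›
  let T : Finset M := Finset.univ.biUnion fun j => (s (v j)).support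
  let toM : (T →₀ P) →ₗ[P] M := Finsupp.linearCombination P Subtype.val
  let ofM : M →ₗ[P] (T →₀ P) := Finsupp.lcomapDomain Subtype.val Subtype.val_injective ∘ₗ s
  have htoM (j : ι) : toM (ofM (v j)) = v j := by
    have hsupp : ((s (v j)).support : Set M) ⊆ Set.range (Subtype.val : T → M) := fun m hm =>
      ⟨⟨m, Finset.mem_biUnion.mpr ⟨j, Finset.mem_univ _, hm⟩⟩, rfl⟩
    have hsv := LinearMap.congr_fun hs (v j)
    rw [LinearMap.comp_apply, ← Finsupp.mapDomain_comapDomain _ Subtype.val_injective _ hsupp,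
      Finsupp.linearCombination_mapDomain] at hsv
    exact hsv
  obtain ⟨c, hc, l', hl'⟩ := exists_linearMap_quotient_of_finitePresentation I (l ∘ₗ toM)
  exact ⟨c, hc, l' ∘ₗ ofM, fun j => (hl' _).trans (by rw [LinearMap.comp_apply, htoM])⟩

lemma exists_mul_mem_of_map_le {S : Type*} [CommRing S] [Algebra P S]
    (N : Submonoid P) [IsLocalization N S] {I J : Ideal P} (hI : I.FG)
    (h : I.map (algebraMap P S) ≤ J.map (algebraMap P S)) :
    ∃ m ∈ N, ∀ x ∈ I, m * x ∈ J := by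
  obtain ⟨s, rfl⟩ := hI
  choose m hm hmx using fun x : s =>
    (IsLocalization.algebraMap_mem_map_algebraMap_iff N S J x.1).mp
      (h (Ideal.mem_map_of_mem _ (Ideal.subset_span x.2)))
  refine ⟨∏ x, m x, prod_mem fun x _ => hm x, fun x hx => ?_⟩
  suffices Ideal.span s ≤ Submodule.comap (LinearMap.mulLeft P (∏ x, m x)) J from this hx
  refine Ideal.span_le.mpr fun y hy => ?_
  exact Ideal.mem_of_dvd J (mul_dvd_mul_right (Finset.dvd_prod_of_mem m
    (Finset.mem_univ (⟨y, hy⟩ : s))) _) (hmx ⟨y, hy⟩)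

end CommonDenominator

section GenericRegularity

open IsLocalRing Algebra

variable {P : Type*} [CommRing P] (I : Ideal P) [I.IsPrime]

lemma exists_basis_cotangentSpace_localization [IsNoetherianRing P] :
    ∃ (r : ℕ) (f : Fin r → P)
      (hf : ∀ j, algebraMap P (Localization.AtPrime I) (f j) ∈ maximalIdeal _)
      (b : Module.Basis (Fin r) I.ResidueField (CotangentSpace (Localization.AtPrime I))),
      ∀ j, b j = (maximalIdeal (Localization.AtPrime I)).toCotangent ⟨_, hf j⟩ := by
  have hmem (x : I) : algebraMap P (Localization.AtPrime I) x ∈ maximalIdeal _ :=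
    (IsLocalization.AtPrime.to_map_mem_maximal_iff _ I x.1).mpr x.2
  have hspan : Submodule.span I.ResidueField (Set.range fun x : I =>
      ((maximalIdeal (Localization.AtPrime I)).toCotangent ⟨_, hmem x⟩ :
        CotangentSpace (Localization.AtPrime I))) = ⊤ := by
    rw [span_range_toCotangent_eq_top_iff, ← IsLocalization.AtPrime.map_eq_maximalIdeal I,
      Ideal.map, Set.image_eq_range]
    rfl
  obtain ⟨v, hv, hvs, hli⟩ := Submodule.exists_fun_fin_finrank_span_eq I.ResidueField
    (Set.range fun x : I => ((maximalIdeal (Localization.AtPrime I)).toCotangent ⟨_, hmem x⟩ :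
        CotangentSpace (Localization.AtPrime I)))
  choose x hx using hv
  exact ⟨_, fun j => x j, fun j => hmem (x j), .mk hli (hvs.trans hspan).ge, fun j =>
    (Module.Basis.mk_apply ..).trans (hx j).symm⟩

lemma map_localization_eq_span_of_basis_cotangentSpace [IsNoetherianRing P] {ι : Type*}
    {f : ι → P} (hf : ∀ j, algebraMap P (Localization.AtPrime I) (f j) ∈ maximalIdeal _)
    (b : Module.Basis ι I.ResidueField (CotangentSpace (Localization.AtPrime I)))
    (hb : ∀ j, b j = (maximalIdeal (Localization.AtPrime I)).toCotangent ⟨_, hf j⟩) :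
    I.map (algebraMap P (Localization.AtPrime I)) =
      (Ideal.span (Set.range f)).map (algebraMap P (Localization.AtPrime I)) := by
  rw [Localization.AtPrime.map_eq_maximalIdeal, Ideal.map_span, ← Set.range_comp]
  refine ((span_range_toCotangent_eq_top_iff hf).mp ?_).symm
  rw [← b.span_eq]
  congr 2
  exact funext fun j => (hb j).symm

lemma exists_derivation_eq_zero_iff_ne (F : Type*) [Field F] [PerfectField F] [Algebra F P]
    [IsNoetherianRing P] [FormallySmooth F P] :
    ∃ (r : ℕ) (f : Fin r → P) (D : Fin r → Derivation F P I.ResidueField),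
      (∀ j, f j ∈ I) ∧ (∀ i j, D i (f j) = 0 ↔ i ≠ j) ∧
      I.map (algebraMap P (Localization.AtPrime I)) =
        (Ideal.span (Set.range f)).map (algebraMap P (Localization.AtPrime I)) := by
  obtain ⟨r, f, hf, b, hb⟩ := exists_basis_cotangentSpace_localization I
  have : FormallySmooth P (Localization.AtPrime I) := .of_isLocalization I.primeCompl
  have : FormallySmooth F (Localization.AtPrime I) := .comp F P _
  have : FormallySmooth F I.ResidueField := formallySmooth_of_perfectField F _
  choose D hD using fun i => exists_derivation_eq_of_formallySmooth (F := F)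
    (A := I.ResidueField) Ideal.Quotient.mk_surjective
    ker_residue ((b.coord i).restrictScalars (Localization.AtPrime I))
  refine ⟨r, f, fun i => (D i).compAlgebraMap P, fun j => ?_, fun i j => ?_, ?_⟩
  · exact (IsLocalization.AtPrime.to_map_mem_maximal_iff _ I (f j)).mp (hf j)
  · have hij : D i (algebraMap P _ (f j)) = b.coord i (b j) := by rw [hD i ⟨_, hf j⟩, hb]; rfl
    rw [Derivation.compAlgebraMap_apply, hij, b.coord_apply, b.repr_self_apply]
    simp [eq_comm]
  · exact map_localization_eq_span_of_basis_cotangentSpace I hf b hb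

lemma exists_derivation_quotient_of_projective {F : Type*} [CommRing F] [Algebra F P]
    [Module.Projective P Ω[P⁄F]] (D : Derivation F P I.ResidueField) {ι : Type*} [Finite ι]
    (f : ι → P) :
    ∃ c ∉ I, ∃ E : Derivation F P (P ⧸ I),
      ∀ j, algebraMap (P ⧸ I) I.ResidueField (E (f j)) = c • D (f j) := by
  obtain ⟨c, hc, l, hl⟩ := exists_linearMap_quotient_of_projective I
    D.liftKaehlerDifferential (fun j => KaehlerDifferential.D F P (f j))
  exact ⟨c, hc, l.compDer (KaehlerDifferential.D F P), fun j => (hl j).trans (by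
    rw [D.liftKaehlerDifferential_comp_D])⟩

lemma isRegularLocalRing_localization_quotient_of_derivation {F : Type*} [CommRing F] [Algebra F P]
    [IsRegularRing P] {ι : Type*} [Finite ι] {f : ι → P} (hf : ∀ j, f j ∈ I)
    (D : ι → Derivation F P I.ResidueField) (hD : ∀ i j, D i (f j) = 0 ↔ i ≠ j) :
    IsRegularLocalRing (Localization.AtPrime I ⧸
      (Ideal.span (Set.range f)).map (algebraMap P (Localization.AtPrime I))) := by
  have : FormallyEtale P (Localization.AtPrime I) := .of_isLocalization I.primeCompl
  choose D' hD' using fun i =>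
    exists_derivation_extending_of_formallyEtale (S := Localization.AtPrime I) (D i)
  have hfm (j) : algebraMap P (Localization.AtPrime I) (f j) ∈ maximalIdeal _ :=
    (IsLocalization.AtPrime.to_map_mem_maximal_iff _ I (f j)).mpr (hf j)
  rw [Ideal.map_span, ← Set.range_comp]
  exact isRegularLocalRing_quotient_span hfm (linearIndependent_toCotangent_of_derivation hfm D'
    fun i j => by rw [hD', hD])

lemma map_localization_eq_of_mul_mem {J K : Ideal P} (hJK : J ≤ K) {m : P} (hm : m ∉ I)
    (h : ∀ x ∈ K, m * x ∈ J) :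
    K.map (algebraMap P (Localization.AtPrime I)) =
      J.map (algebraMap P (Localization.AtPrime I)) :=
  le_antisymm (Ideal.map_le_iff_le_comap.mpr fun x hx =>
    (IsLocalization.algebraMap_mem_map_algebraMap_iff I.primeCompl _ J x).mpr ⟨m, hm, h x hx⟩)
    (Ideal.map_mono hJK)

lemma exists_notMem_isRegularLocalRing_quotient (F : Type*) [Field F] [PerfectField F]
    [Algebra F P] [IsRegularRing P] [FormallySmooth F P] :
    ∃ h ∉ I, ∀ (Q : Ideal P) [Q.IsPrime], I ≤ Q → h ∉ Q → IsRegularLocalRing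
      (Localization.AtPrime Q ⧸ I.map (algebraMap P (Localization.AtPrime Q))) := by
  obtain ⟨r, f, D, hfI, hD, hmap⟩ := exists_derivation_eq_zero_iff_ne I F
  obtain ⟨m, hm, hmI⟩ := exists_mul_mem_of_map_le I.primeCompl (IsNoetherian.noetherian I) hmap.le
  choose c hc E hE using fun i => exists_derivation_quotient_of_projective I (D i) f
  have hE_eq_zero_iff (i j) : E i (f j) = 0 ↔ i ≠ j := by
    rw [← hD, ← (IsFractionRing.injective (P ⧸ I) I.ResidueField).eq_iff, map_zero, hE,
      Algebra.smul_def, mul_eq_zero, Ideal.algebraMap_residueField_eq_zero, or_iff_right (hc i)]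
  choose e he using fun i => Ideal.Quotient.mk_surjective (E i (f i))
  have heI (i) : e i ∉ I := by
    rw [← Ideal.Quotient.eq_zero_iff_mem, he, hE_eq_zero_iff, ne_eq, not_not]
  refine ⟨m * ∏ i, e i, fun h => ?_, fun Q _ hIQ hQ => ?_⟩
  · rcases Ideal.IsPrime.mem_or_mem ‹_› h with h | h
    · exact hm h
    · obtain ⟨i, -, hi⟩ := Ideal.IsPrime.prod_mem_iff.mp h
      exact heI i hi
  have hmQ : m ∉ Q := fun h => hQ (Q.mul_mem_right _ h)
  have heQ (i) : e i ∉ Q := fun h => hQ (Q.mul_mem_left _ (Ideal.mem_of_dvd _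
    (Finset.dvd_prod_of_mem e (Finset.mem_univ i)) h))
  rw [map_localization_eq_of_mul_mem Q (Ideal.span_le.mpr (Set.range_subset_iff.mpr hfI)) hmQ hmI]
  let toResidueField : P ⧸ I →ₐ[P] Q.ResidueField := Ideal.Quotient.liftₐ I (ofId P _) fun x hx =>
    Ideal.algebraMap_residueField_eq_zero.mpr (hIQ hx)
  refine isRegularLocalRing_localization_quotient_of_derivation Q (fun j => hIQ (hfI j))
    (fun i => toResidueField.toLinearMap.compDer (E i)) fun i j => ?_
  change toResidueField (E i (f j)) = 0 ↔ _
  refine ⟨?_, fun hij => by rw [(hE_eq_zero_iff i j).mpr hij, map_zero]⟩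
  rintro h rfl
  rw [← he] at h
  exact heQ i (Ideal.algebraMap_residueField_eq_zero.mp h)

end GenericRegularity

section QuotientLocalization

variable {P A : Type*} [CommRing P] [CommRing A]

lemma nonempty_localization_quotient_equiv {φ : P →+* A} (hφ : Function.Surjective φ)
    (p q : Ideal A) [q.IsPrime] :
    Nonempty (Localization.AtPrime (q.comap φ) ⧸
        (p.comap φ).map (algebraMap P (Localization.AtPrime (q.comap φ))) ≃+*
      Localization.AtPrime q ⧸ p.map (algebraMap A (Localization.AtPrime q))) := by
  let e : P ⧸ p.comap φ ≃+* A ⧸ p := RingEquiv.ofBijective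
    (Ideal.quotientMap p φ le_rfl)
    ⟨Ideal.quotientMap_injective, Ideal.quotientMap_surjective hφ⟩
  refine ⟨IsLocalization.ringEquivOfRingEquiv
    (M := Algebra.algebraMapSubmonoid (P ⧸ p.comap φ) (q.comap φ).primeCompl)
    (T := Algebra.algebraMapSubmonoid (A ⧸ p) q.primeCompl) _ _ e ?_⟩
  ext y
  constructor
  · rintro ⟨_, ⟨x, hx, rfl⟩, rfl⟩
    exact ⟨φ x, hx, rfl⟩
  · rintro ⟨x, hx, rfl⟩
    obtain ⟨x, rfl⟩ := hφ x
    exact ⟨_, ⟨x, hx, rfl⟩, rfl⟩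

end QuotientLocalization

section RegularLocus

open IsLocalRing Algebra

lemma height_add_ringKrullDim_quotient_le {R : Type*} [CommRing R] (J : Ideal R) [J.IsPrime] :
    J.height + ringKrullDim (R ⧸ J) ≤ ringKrullDim R := by
  let x : PrimeSpectrum R := ⟨J, ‹_›⟩
  have : Nonempty (PrimeSpectrum R) := ⟨x⟩
  have hzero : PrimeSpectrum.zeroLocus (J : Set R) = Set.Ici x := rfl
  rw [show J.height = Order.height x from PrimeSpectrum.height_eq_orderHeight x,
    ringKrullDim_quotient, hzero, ← Order.coheight_eq_krullDim_Ici, ringKrullDim,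
    Order.krullDim_eq_iSup_height_add_coheight_of_nonempty]
  exact_mod_cast le_iSup (fun y : PrimeSpectrum R => Order.height y + Order.coheight y) x

lemma spanFinrank_le_spanFinrank_add_spanFinrank_map {R : Type*} [CommRing R] {I J : Ideal R}
    (hI : I.FG) (hJ : J.FG) (hJI : J ≤ I) :
    I.spanFinrank ≤ J.spanFinrank + (I.map (Ideal.Quotient.mk J)).spanFinrank := by
  classical
  obtain ⟨s, hs, hsJ⟩ := Submodule.FG.exists_span_finset_card_eq_spanFinrank hJ
  obtain ⟨t, ht, htI⟩ := Submodule.FG.exists_span_finset_card_eq_spanFinrank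
    (hI.map (Ideal.Quotient.mk J))
  choose l hl using Ideal.Quotient.mk_surjective (I := J)
  have hIst : I = Ideal.span ((s ∪ t.image l : Finset R) : Set R) := by
    have hmap : (Ideal.span (t.image l : Set R)).map (Ideal.Quotient.mk J) =
        I.map (Ideal.Quotient.mk J) := by
      rw [Ideal.map_span, Finset.coe_image, ← Set.image_comp, ← htI]
      exact congrArg Ideal.span ((Set.image_congr' hl).trans (Set.image_id _))
    rw [Finset.coe_union, Ideal.span_union, show Ideal.span (s : Set R) = J from hsJ, sup_comm,
      ← sup_eq_left.mpr hJI]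
    simpa only [Ideal.comap_map_of_surjective _ Ideal.Quotient.mk_surjective,
      ← RingHom.ker_eq_comap_bot, Ideal.mk_ker] using
      congrArg (Ideal.comap (Ideal.Quotient.mk J)) hmap.symm
  rw [← hs, ← ht]
  conv_lhs => rw [hIst]
  refine (Submodule.spanFinrank_span_le_ncard_of_finite (Finset.finite_toSet _)).trans ?_
  rw [Set.ncard_coe_finset]
  exact (Finset.card_union_le _ _).trans (by gcongr; exact Finset.card_image_le)

lemma isRegularLocalRing_of_quotient {R : Type*} [CommRing R] [IsLocalRing R] [IsNoetherianRing R]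
    (J : Ideal R) [J.IsPrime] (hJ : J.spanFinrank ≤ J.height) [IsRegularLocalRing (R ⧸ J)] :
    IsRegularLocalRing R := by
  refine IsRegularLocalRing.of_spanFinrank_maximalIdeal_le _ ?_
  have hspan := spanFinrank_le_spanFinrank_add_spanFinrank_map
    (IsNoetherian.noetherian (maximalIdeal R)) (IsNoetherian.noetherian J)
    (le_maximalIdeal Ideal.IsPrime.ne_top')
  rw [map_maximalIdeal_of_surjective _ Ideal.Quotient.mk_surjective] at hspan
  calc ((maximalIdeal R).spanFinrank : WithBot ℕ∞)
      ≤ J.spanFinrank + (maximalIdeal (R ⧸ J)).spanFinrank := by exact_mod_cast hspan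
    _ ≤ J.height + ringKrullDim (R ⧸ J) := by
        rw [← (isRegularLocalRing_iff (R ⧸ J)).mp inferInstance]
        gcongr
        exact_mod_cast hJ
    _ ≤ ringKrullDim R := height_add_ringKrullDim_quotient_le J

lemma exists_perfectField_algebra (k : Type*) [Field k] :
    ∃ (F : Type) (_ : Field F) (_ : PerfectField F), Nonempty (Algebra F k) := by
  obtain ⟨c, hc⟩ := CharP.exists k
  rcases CharP.char_is_prime_or_zero k c with hp | rfl
  · have : Fact c.Prime := ⟨hp⟩
    exact ⟨ZMod c, inferInstance, inferInstance, ⟨ZMod.algebra k c⟩⟩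
  · have := CharP.charP_to_charZero k
    exact ⟨ℚ, inferInstance, inferInstance, ⟨inferInstance⟩⟩

variable {A : Type*} [CommRing A]

lemma exists_notMem_isRegularLocalRing_quotient_of_finiteType (k : Type*) [Field k] [Algebra k A]
    [FiniteType k A] (p : Ideal A) [p.IsPrime] :
    ∃ h ∉ p, ∀ (q : Ideal A) [q.IsPrime], p ≤ q → h ∉ q → IsRegularLocalRing
      (Localization.AtPrime q ⧸ p.map (algebraMap A (Localization.AtPrime q))) := by
  obtain ⟨n, φ, hφ⟩ := FiniteType.iff_quotient_mvPolynomial''.mp ‹FiniteType k A›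
  obtain ⟨F, _, _, ⟨_⟩⟩ := exists_perfectField_algebra k
  have := formallySmooth_of_perfectField F k
  have : FormallySmooth F (MvPolynomial (Fin n) k) := .comp F k _
  obtain ⟨h, hp, H⟩ := exists_notMem_isRegularLocalRing_quotient (p.comap φ.toRingHom) F
  refine ⟨φ h, hp, fun q _ hpq hq => ?_⟩
  have := H (q.comap φ.toRingHom) (Ideal.comap_mono hpq) hq
  obtain ⟨e⟩ := nonempty_localization_quotient_equiv (φ := φ.toRingHom) hφ p q
  exact .of_ringEquiv e

lemma exists_notMem_isRegularLocalRing (k : Type*) [Field k] [Algebra k A] [FiniteType k A]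
    (p : Ideal A) [p.IsPrime] [IsRegularLocalRing (Localization.AtPrime p)] :
    ∃ h ∉ p, ∀ (q : Ideal A) [q.IsPrime], p ≤ q → h ∉ q →
      IsRegularLocalRing (Localization.AtPrime q) := by
  have : IsNoetherianRing A := FiniteType.isNoetherianRing k A
  obtain ⟨h, hp, H⟩ := exists_notMem_isRegularLocalRing_quotient_of_finiteType k p
  obtain ⟨r, f, hf, b, hb⟩ := exists_basis_cotangentSpace_localization p
  have hr : (r : ℕ∞) = p.height := by
    have := (IsRegularLocalRing.iff_finrank_cotangentSpace (Localization.AtPrime p)).mp ‹_›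
    rw [Module.finrank_eq_nat_card_basis b, Nat.card_fin,
      IsLocalization.AtPrime.ringKrullDim_eq_height p] at this
    exact_mod_cast this
  have hfp : Ideal.span (Set.range f) ≤ p := Ideal.span_le.mpr (Set.range_subset_iff.mpr fun j =>
    (IsLocalization.AtPrime.to_map_mem_maximal_iff _ p (f j)).mp (hf j))
  obtain ⟨m, hm, hmp⟩ := exists_mul_mem_of_map_le p.primeCompl (IsNoetherian.noetherian p)
    (map_localization_eq_span_of_basis_cotangentSpace p hf b hb).le
  refine ⟨h * m, fun hhm => (Ideal.IsPrime.mem_or_mem ‹_› hhm).elim hp hm, fun q _ hpq hq => ?_⟩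
  have hmq : m ∉ q := fun hmem => hq (q.mul_mem_left _ hmem)
  have := H q hpq fun hmem => hq (q.mul_mem_right _ hmem)
  have hdisj : Disjoint (q.primeCompl : Set A) p :=
    Set.disjoint_left.mpr fun x hx hxp => hx (hpq hxp)
  have : (p.map (algebraMap A (Localization.AtPrime q))).IsPrime :=
    IsLocalization.isPrime_of_isPrime_disjoint q.primeCompl _ p ‹_› hdisj
  refine isRegularLocalRing_of_quotient (p.map (algebraMap A (Localization.AtPrime q))) ?_
  rw [IsLocalization.height_map_of_disjoint q.primeCompl p hdisj, ← hr,
    map_localization_eq_of_mul_mem q hfp hmq hmp, Nat.cast_le]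
  refine (Ideal.spanFinrank_map_le_of_fg _ (Submodule.fg_span (Set.finite_range f))).trans ?_
  exact (Submodule.spanFinrank_span_le_ncard_of_finite (Set.finite_range f)).trans
    ((Finite.card_range_le f).trans_eq (Nat.card_fin r))

lemma ideal_induction_of_isPrime [IsNoetherianRing A]
    {motive : Ideal A → Prop} (top : motive ⊤)
    (prime : ∀ I : Ideal A, I.IsPrime → (∀ h ∉ I, motive (I ⊔ Ideal.span {h})) → motive I)
    (mul_mem : ∀ (I : Ideal A) (x y : A), x * y ∈ I → motive (I ⊔ Ideal.span {x}) →
      motive (I ⊔ Ideal.span {y}) → motive I) (I : Ideal A) : motive I := by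
  induction I using WellFoundedGT.induction with
  | ind I ih =>
    have ih_sup (h) (hh : h ∉ I) : motive (I ⊔ Ideal.span {h}) :=
      ih _ (left_lt_sup.mpr fun hle => hh (hle (Ideal.mem_span_singleton_self h)))
    by_cases hI : I.IsPrime
    · exact prime I hI ih_sup
    · rcases Ideal.not_isPrime_iff.mp hI with rfl | ⟨x, hx, y, hy, hxy⟩
      · exact top
      · exact mul_mem I x y hxy (ih_sup x hx) (ih_sup y hy)

lemma finite_setOf_not_isRegularLocalRing (k : Type*) [Field k] [Algebra k A] [FiniteType k A]
    (a : ℕ)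
    (hA : ∀ (q : Ideal A) [q.IsPrime], q.height ≤ a → IsRegularLocalRing (Localization.AtPrime q)) :
    {q : PrimeSpectrum A | q.asIdeal.height = a + 1 ∧
      ¬ IsRegularLocalRing (Localization.AtPrime q.asIdeal)}.Finite := by
  have : IsNoetherianRing A := FiniteType.isNoetherianRing k A
  set s := {q : PrimeSpectrum A | q.asIdeal.height = a + 1 ∧
      ¬ IsRegularLocalRing (Localization.AtPrime q.asIdeal)}
  suffices ∀ I : Ideal A, {q ∈ s | I ≤ q.asIdeal}.Finite by simpa using this ⊥
  have hsup {I : Ideal A} {h : A} {q : PrimeSpectrum A} (hI : I ≤ q.asIdeal)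
      (hh : h ∈ q.asIdeal) : I ⊔ Ideal.span {h} ≤ q.asIdeal :=
    sup_le hI ((Ideal.span_singleton_le_iff_mem _).mpr hh)
  intro I
  induction I using ideal_induction_of_isPrime with
  | top =>
    exact Set.finite_empty.subset fun q hq => q.isPrime.ne_top (top_le_iff.mp hq.2)
  | prime I hI ih =>
    by_cases hreg : IsRegularLocalRing (Localization.AtPrime I)
    · obtain ⟨h, hhI, H⟩ := exists_notMem_isRegularLocalRing k I
      refine (ih h hhI).subset fun q ⟨hq, hIq⟩ => ⟨hq, hsup hIq ?_⟩
      by_contra hh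
      exact hq.2 (H q.asIdeal hIq hh)
    · refine (Set.finite_singleton (⟨I, hI⟩ : PrimeSpectrum A)).subset fun q ⟨hq, hIq⟩ => ?_
      by_contra hne
      have hlt : I < q.asIdeal := lt_of_le_of_ne hIq fun h => hne (PrimeSpectrum.ext h.symm)
      refine hreg (hA I ((ENat.add_le_add_iff_right ENat.one_ne_top).mp ?_))
      exact (Ideal.height_add_one_le_of_lt_of_isPrime hlt).trans_eq hq.1
  | mul_mem I x y hxy hx hy =>
    refine (hx.union hy).subset fun q ⟨hq, hIq⟩ => ?_
    exact (q.isPrime.mem_or_mem (hIq hxy)).imp (fun h => ⟨hq, hsup hIq h⟩)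
      fun h => ⟨hq, hsup hIq h⟩

end RegularLocus

section TranscendenceDegree

open Algebra TensorProduct

lemma formallyUnramified_adjoin_of_span_D {k K : Type*} [Field k] [Field K] [Algebra k K]
    {s : Set K} (hs : Submodule.span K (KaehlerDifferential.D k K '' s) = ⊤) :
    FormallyUnramified (IntermediateField.adjoin k s) K := by
  let L := IntermediateField.adjoin k s
  have hmap : KaehlerDifferential.map k L K K = 0 := by
    refine LinearMap.ext_on hs ?_
    rintro _ ⟨x, hx, rfl⟩
    rw [KaehlerDifferential.map_D, algebraMap_self_apply]
    exact (KaehlerDifferential.D L K).map_algebraMap ⟨x, IntermediateField.subset_adjoin k s hx⟩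
  refine ⟨subsingleton_of_forall_eq 0 fun y => ?_⟩
  obtain ⟨z, rfl⟩ := KaehlerDifferential.map_surjective k L K y
  exact LinearMap.congr_fun hmap z

open scoped IntermediateField.algebraAdjoinAdjoin in
lemma trdeg_le_finrank_kaehlerDifferential (k K : Type*) [Field k] [Field K] [Algebra k K]
    [EssFiniteType k K] : trdeg k K ≤ Module.finrank K Ω[K⁄k] := by
  obtain ⟨κ, x, -, hspan, hli⟩ := exists_linearIndependent' K (KaehlerDifferential.D k K)
  rw [KaehlerDifferential.span_range_derivation] at hspan
  let L := IntermediateField.adjoin k (Set.range x)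
  have : FormallyUnramified L K :=
    formallyUnramified_adjoin_of_span_D (by rw [← Set.range_comp, hspan])
  have : EssFiniteType L K := .of_comp k L K
  have : Algebra.IsSeparable L K := FormallyUnramified.isSeparable L K
  have : Algebra.IsAlgebraic (adjoin k (Set.range x)) K :=
    (IsFractionRing.comap_isAlgebraic_iff (K := L)).mpr inferInstance
  have : Finite κ := hli.finite
  have hcard : Module.finrank K Ω[K⁄k] = Nat.card κ :=
    Module.finrank_eq_nat_card_basis (Module.Basis.mk hli hspan.ge)
  refine (IsAlgebraic.trdeg_le_cardinalMk k (Set.range x)).trans ?_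
  rw [hcard, Nat.cast_card]
  exact Cardinal.mk_range_le

lemma trdeg_residueField_le (k : Type*) {A : Type*} [Field k] [CommRing A] [Algebra k A]
    [FiniteType k A] (p : Ideal A) [p.IsPrime] :
    trdeg k p.ResidueField ≤ Module.finrank p.ResidueField (p.ResidueField ⊗[A] Ω[A⁄k]) := by
  have : EssFiniteType (Localization.AtPrime p) p.ResidueField :=
    .of_surjective (IsScalarTower.toAlgHom _ (Localization.AtPrime p) _)
      IsLocalRing.residue_surjective
  have : EssFiniteType k p.ResidueField := .comp k (Localization.AtPrime p) _
  have : FormallyUnramified A (Localization.AtPrime p) := .of_isLocalization p.primeCompl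
  have : FormallyUnramified A p.ResidueField := .comp A (Localization.AtPrime p) p.ResidueField
  have hsurj : Function.Surjective (KaehlerDifferential.mapBaseChange k A p.ResidueField) :=
    fun y => (KaehlerDifferential.exact_mapBaseChange_map k A p.ResidueField y).mp
      (Subsingleton.elim _ _)
  exact (trdeg_le_finrank_kaehlerDifferential k p.ResidueField).trans
    (by exact_mod_cast LinearMap.finrank_le_finrank_of_surjective hsurj)

end TranscendenceDegree

section LinearForms

open Algebra MvPolynomial

lemma not_algebraicIndependent_of_trdeg_lt {k K : Type*} [Field k] [Field K] [Algebra k K]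
    {m r N : ℕ} (hr : trdeg k K < r) (hN : m + r ≤ N) (y : Fin N → MvPolynomial (Fin m) K) :
    ¬ AlgebraicIndependent k y := by
  intro hy
  have hle := hy.lift_cardinalMk_le_trdeg
  rw [← trdeg_add_eq k K, MvPolynomial.trdeg_of_isDomain] at hle
  obtain ⟨t, ht⟩ := Cardinal.lt_aleph0.mp (hr.trans Cardinal.natCast_lt_aleph0)
  rw [ht] at hle hr
  simp only [Cardinal.mk_fintype, Fintype.card_fin, Cardinal.lift_natCast,
    ← Nat.cast_add, Nat.cast_le, Nat.cast_lt] at hle hr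
  lia

/-- Modulo the forms only `N - r` of the variables remain, so the residues of all `N` variables lie
in a ring of transcendence degree less than `N` over `k`. -/
lemma exists_map_mem_span_linearForms {k K : Type*} [Field k] [Field K] [Algebra k K] {r N : ℕ}
    (hr : trdeg k K < r) {R : Fin r → Fin N → K} (hR : LinearIndependent K R) :
    ∃ Φ : MvPolynomial (Fin N) k, Φ ≠ 0 ∧
      map (algebraMap k K) Φ ∈ Ideal.span (Set.range fun i => ∑ j, C (R i j) * X j) := by
  let W := Submodule.span K (Set.range R)
  let b := Module.finBasis K ((Fin N → K) ⧸ W)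
  have hm : Module.finrank K ((Fin N → K) ⧸ W) + r = N := by
    have := W.finrank_quotient_add_finrank
    rwa [finrank_span_eq_card hR, Fintype.card_fin, Module.finrank_fin_fun] at this
  let y (j : Fin N) : MvPolynomial (Fin (Module.finrank K ((Fin N → K) ⧸ W))) K :=
    ∑ t, C (b.repr (W.mkQ (Pi.single j 1)) t) * X t
  have hy := not_algebraicIndependent_of_trdeg_lt hr hm.le y
  rw [algebraicIndependent_iff] at hy
  push Not at hy
  obtain ⟨Φ, hΦy, hΦ⟩ := hy
  refine ⟨Φ, hΦ, ?_⟩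
  set J := Ideal.span (Set.range fun i => ∑ j, C (R i j) * X j)
  let L : (Fin N → K) →ₗ[K] MvPolynomial (Fin N) K ⧸ J :=
    (Ideal.Quotient.mkₐ K J).toLinearMap ∘ₗ Fintype.linearCombination K X
  have hL (j) : L (Pi.single j 1) = Ideal.Quotient.mkₐ K J (X j) := by simp [L]
  have hWL : W ≤ LinearMap.ker L := Submodule.span_le.mpr <| by
    rintro _ ⟨i, rfl⟩
    refine Ideal.Quotient.eq_zero_iff_mem.mpr ?_
    rw [Fintype.linearCombination_apply]
    simp only [smul_eq_C_mul]
    exact Ideal.subset_span ⟨i, rfl⟩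
  have haeval : ((aeval (W.liftQ L hWL ∘ b)).restrictScalars k).comp (aeval y) =
      ((Ideal.Quotient.mkₐ K J).restrictScalars k).comp (mapAlgHom (Algebra.ofId k K)) := by
    ext j
    have hsum := congrArg (W.liftQ L hWL) (b.sum_repr (W.mkQ (Pi.single j 1)))
    rw [map_sum, Submodule.mkQ_apply, Submodule.liftQ_apply, hL] at hsum
    have hsmul (c : K) (z : MvPolynomial (Fin N) K ⧸ J) : c • z = algebraMap K _ c * z :=
      Algebra.smul_def c z
    simpa [y, hsmul] using hsum
  have := DFunLike.congr_fun haeval Φ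
  rw [AlgHom.comp_apply, hΦy, map_zero] at this
  exact Ideal.Quotient.eq_zero_iff_mem.mp this.symm

attribute [local instance] algebraMvPolynomial in
lemma exists_forall_exists_linearForm_notMem {k B : Type*} (K : Type*) [Field k] [CommRing B]
    [IsDomain B] [Field K] [Algebra k B] [Algebra B K] [Algebra k K] [IsScalarTower k B K]
    [IsFractionRing B K] {r N : ℕ} (hr : trdeg k K < r) {R : Fin r → Fin N → B}
    (hR : LinearIndependent B R) :
    ∃ Φ : MvPolynomial (Fin N) k, Φ ≠ 0 ∧ ∃ h : B, h ≠ 0 ∧ ∀ v : Fin N → k, eval v Φ ≠ 0 →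
      ∀ (q : Ideal B) [q.IsPrime], h ∉ q → ∃ i, ∑ j, v j • R i j ∉ q := by
  obtain ⟨Φ, hΦ, hmem⟩ := exists_map_mem_span_linearForms hr
    (R := fun i j => algebraMap B K (R i j))
    ((LinearIndependent.iff_fractionRing B K).mp
      (hR.map' ((Algebra.linearMap B K).compLeft (Fin N))
        (LinearMap.ker_eq_bot.mpr (IsFractionRing.injective B K).comp_left)))
  let J : Ideal (MvPolynomial (Fin N) B) := Ideal.span (Set.range fun i => ∑ j, C (R i j) * X j)
  have hJ : algebraMap _ (MvPolynomial (Fin N) K) (map (algebraMap k B) Φ) ∈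
      J.map (algebraMap _ (MvPolynomial (Fin N) K)) := by
    rw [algebraMap_def, map_map, ← IsScalarTower.algebraMap_eq, Ideal.map_span, ← Set.range_comp]
    simpa [Function.comp_def] using hmem
  obtain ⟨_, ⟨h, hh, rfl⟩, hhJ⟩ := (IsLocalization.algebraMap_mem_map_algebraMap_iff
    ((nonZeroDivisors B).map (C (σ := Fin N))) _ J _).mp hJ
  refine ⟨Φ, hΦ, h, nonZeroDivisors.ne_zero hh, fun v hv q _ hq => ?_⟩
  by_contra! hRq
  have hJq : J.map (eval fun j => algebraMap k B (v j)) ≤ q := by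
    rw [Ideal.map_span, ← Set.range_comp, Ideal.span_le, Set.range_subset_iff]
    intro i
    simpa [Algebra.smul_def, mul_comm] using hRq i
  have := hJq (Ideal.mem_map_of_mem _ hhJ)
  have heval : eval (fun j => algebraMap k B (v j)) (map (algebraMap k B) Φ) =
      algebraMap k B (eval v Φ) := by
    rw [MvPolynomial.eval_map, eval₂_comp]
    rfl
  rw [map_mul, eval_C, heval, Ideal.mul_unit_mem_iff_mem _ ((IsUnit.mk0 _ hv).map _)] at this
  exact hq this

end LinearForms

section GeneralMember

open Algebra TensorProduct IsLocalRing

lemma derivation_sum_apply {F P M ι : Type*} [CommRing F] [CommRing P] [Algebra F P]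
    [AddCommGroup M] [Module F M] [Module P M] (t : Finset ι) (E : ι → Derivation F P M) (x : P) :
    (∑ i ∈ t, E i) x = ∑ i ∈ t, E i x :=
  (congrFun (map_sum Derivation.coeFnAddMonoidHom E t) x).trans (Finset.sum_apply x t _)

lemma exists_linearIndependent_derivation_quotient (k : Type*) {A : Type*} [Field k] [CommRing A]
    [Algebra k A] [FiniteType k A] (p : Ideal A) [p.IsPrime] :
    ∃ (w : ℕ) (E : Fin w → Derivation k A (A ⧸ p)), LinearIndependent (A ⧸ p) E ∧
      trdeg k p.ResidueField ≤ w := by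
  have : IsNoetherianRing A := FiniteType.isNoetherianRing k A
  have : Module.FinitePresentation A Ω[A⁄k] := Module.finitePresentation_of_finite A _
  let b := Module.finBasis p.ResidueField (p.ResidueField ⊗[A] Ω[A⁄k])
  choose c hc l hl using fun i => exists_linearMap_quotient_of_finitePresentation p
    ((b.coord i).restrictScalars A ∘ₗ TensorProduct.mk A p.ResidueField Ω[A⁄k] 1)
  refine ⟨_, fun i => (l i).compDer (KaehlerDifferential.D k A),
    Fintype.linearIndependent_iff.mpr fun g hg i => ?_, trdeg_residueField_le k p⟩
  have hcoord : ∑ i, (algebraMap (A ⧸ p) p.ResidueField (g i) * algebraMap A _ (c i)) •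
      b.coord i = 0 := by
    ext a
    have := congrArg (algebraMap (A ⧸ p) p.ResidueField)
      ((derivation_sum_apply _ _ a).symm.trans (DFunLike.congr_fun hg a))
    simpa [hl, Algebra.smul_def (A := p.ResidueField), mul_assoc] using this
  rw [← b.coe_dualBasis] at hcoord
  have := Fintype.linearIndependent_iff.mp b.dualBasis.linearIndependent _ hcoord i
  simpa [hc i] using this

lemma derivation_quotient_mem_of_mem_sq {k A : Type*} [CommRing k] [CommRing A] [Algebra k A]
    {p q : Ideal A} [q.IsPrime] (hpq : p ≤ q) (D : Derivation k A (A ⧸ p)) {x : A}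
    (hx : algebraMap A (Localization.AtPrime q) x ∈ maximalIdeal (Localization.AtPrime q) ^ 2) :
    D x ∈ q.map (Ideal.Quotient.mk p) := by
  let π : A ⧸ p →ₗ[A] A ⧸ q := (Ideal.Quotient.factorₐ A hpq).toLinearMap
  let ι : A ⧸ q →ₗ[A] q.ResidueField := (IsScalarTower.toAlgHom A (A ⧸ q) _).toLinearMap
  have : FormallyEtale A (Localization.AtPrime q) := .of_isLocalization q.primeCompl
  obtain ⟨D', hD'⟩ := exists_derivation_extending_of_formallyEtale (S := Localization.AtPrime q)
    ((ι ∘ₗ π).compDer D)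
  have hD'x := derivation_eq_zero_of_mem_sq D' (fun a ha m => by
    rw [Algebra.smul_def, ResidueField.algebraMap_eq, (residue_eq_zero_iff a).mpr ha, zero_mul]) hx
  have hzero : π (D x) = 0 := IsFractionRing.injective (A ⧸ q) q.ResidueField
    (((hD' x).symm.trans hD'x).trans (map_zero _).symm)
  obtain ⟨y, hy⟩ := Ideal.Quotient.mk_surjective (D x)
  rw [← hy] at hzero ⊢
  exact Ideal.mem_map_of_mem _ (Ideal.Quotient.eq_zero_iff_mem.mp hzero)

/-- The functions `s j` separate 1-jets: over every point `p` of `Spec A`, no nonzero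
first-order differential operator `c + D` with values in the functions on the closure of `p`
annihilates all of them. For sections of a linear system this says that it has no base points and
separates tangent vectors. -/
def SeparatesJets (k : Type*) {A ι : Type*} [CommRing k] [CommRing A] [Algebra k A]
    (s : ι → A) : Prop :=
  ∀ (p : Ideal A) [p.IsPrime] (c : A ⧸ p) (D : Derivation k A (A ⧸ p)),
    (∀ j, c * Ideal.Quotient.mk p (s j) + D (s j) = 0) → c = 0 ∧ D = 0

open MvPolynomial

variable {k A : Type*} [Field k] [CommRing A] [Algebra k A] {N : ℕ} {s : Fin N → A}

lemma exists_notMem_forall_notMem_sq [FiniteType k A] (hs : SeparatesJets k s) (p : Ideal A)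
    [p.IsPrime] :
    ∃ Φ : MvPolynomial (Fin N) k, Φ ≠ 0 ∧ ∃ h ∉ p, ∀ v : Fin N → k, eval v Φ ≠ 0 →
      ∀ (q : Ideal A) [q.IsPrime], p ≤ q → h ∉ q →
        algebraMap A (Localization.AtPrime q) (∑ j, v j • s j) ∉ maximalIdeal _ ^ 2 := by
  obtain ⟨w, E, hE, hw⟩ := exists_linearIndependent_derivation_quotient k p
  let R : Fin (w + 1) → Fin N → A ⧸ p :=
    Fin.cons (fun j => Ideal.Quotient.mk p (s j)) fun i j => E i (s j)
  have hR : LinearIndependent (A ⧸ p) R := by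
    refine Fintype.linearIndependent_iff.mpr fun g hg => ?_
    obtain ⟨h0, hD⟩ := hs p (g 0) (∑ i, g i.succ • E i) fun j => by
      rw [derivation_sum_apply]
      simpa [R, Fin.sum_univ_succ] using congrFun hg j
    exact Fin.cases h0 (Fintype.linearIndependent_iff.mp hE _ hD)
  obtain ⟨Φ, hΦ, h, hh, H⟩ := exists_forall_exists_linearForm_notMem p.ResidueField
    (hw.trans_lt (by exact_mod_cast w.lt_succ_self)) hR
  obtain ⟨h, rfl⟩ := Ideal.Quotient.mk_surjective h
  refine ⟨Φ, hΦ, h, fun hp => hh (Ideal.Quotient.eq_zero_iff_mem.mpr hp),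
    fun v hv q _ hpq hq hsq => ?_⟩
  have : (q.map (Ideal.Quotient.mk p)).IsPrime :=
    Ideal.isPrime_map_quotientMk_of_isPrime hpq
  obtain ⟨i, hi⟩ := H v hv (q.map (Ideal.Quotient.mk p))
    (by rwa [Ideal.mem_quotient_iff_mem hpq])
  refine hi ?_
  cases i using Fin.cases with
  | zero =>
    have hmem : ∑ j, v j • s j ∈ q := (IsLocalization.AtPrime.to_map_mem_maximal_iff _ q _).mp
      (Ideal.pow_le_self two_ne_zero hsq)
    simpa [R, Algebra.smul_def] using Ideal.mem_map_of_mem (Ideal.Quotient.mk p) hmem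
  | succ i => simpa [R] using derivation_quotient_mem_of_mem_sq hpq (E i) hsq

lemma exists_forall_notMem_sq [FiniteType k A] (hs : SeparatesJets k s) :
    ∃ Φ : MvPolynomial (Fin N) k, Φ ≠ 0 ∧ ∀ v : Fin N → k, eval v Φ ≠ 0 →
      ∀ (q : Ideal A) [q.IsPrime],
        algebraMap A (Localization.AtPrime q) (∑ j, v j • s j) ∉ maximalIdeal _ ^ 2 := by
  have : IsNoetherianRing A := FiniteType.isNoetherianRing k A
  suffices ∀ I : Ideal A, ∃ Φ : MvPolynomial (Fin N) k, Φ ≠ 0 ∧ ∀ v : Fin N → k, eval v Φ ≠ 0 →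
      ∀ (q : Ideal A) [q.IsPrime], I ≤ q →
        algebraMap A (Localization.AtPrime q) (∑ j, v j • s j) ∉ maximalIdeal _ ^ 2 by
    simpa using this ⊥
  have hsup {I q : Ideal A} {h : A} (hI : I ≤ q) (hh : h ∈ q) : I ⊔ Ideal.span {h} ≤ q :=
    sup_le hI ((Ideal.span_singleton_le_iff_mem _).mpr hh)
  intro I
  induction I using ideal_induction_of_isPrime with
  | top => exact ⟨1, one_ne_zero, fun v _ q hq h => absurd (top_le_iff.mp h) hq.ne_top⟩
  | prime I hI ih =>
    obtain ⟨Φ, hΦ, h, hh, hΦq⟩ := exists_notMem_forall_notMem_sq hs I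
    obtain ⟨Ψ, hΨ, hΨq⟩ := ih h hh
    refine ⟨Φ * Ψ, mul_ne_zero hΦ hΨ, fun v hv q _ hIq => ?_⟩
    rw [map_mul, mul_ne_zero_iff] at hv
    by_cases hq : h ∈ q
    · exact hΨq v hv.2 q (hsup hIq hq)
    · exact hΦq v hv.1 q hIq hq
  | mul_mem I x y hxy hx hy =>
    obtain ⟨Φ, hΦ, hΦq⟩ := hx
    obtain ⟨Ψ, hΨ, hΨq⟩ := hy
    refine ⟨Φ * Ψ, mul_ne_zero hΦ hΨ, fun v hv q hq hIq => ?_⟩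
    rw [map_mul, mul_ne_zero_iff] at hv
    rcases hq.mem_or_mem (hIq hxy) with hxq | hyq
    · exact hΦq v hv.1 q (hsup hIq hxq)
    · exact hΨq v hv.2 q (hsup hIq hyq)

lemma exists_forall_sum_smul_notMem {q : Ideal A} (hq : ∃ j, s j ∉ q) :
    ∃ Φ : MvPolynomial (Fin N) k, Φ ≠ 0 ∧ ∀ v : Fin N → k, eval v Φ ≠ 0 →
      ∑ j, v j • s j ∉ q := by
  obtain ⟨j, hj⟩ := hq
  obtain ⟨f, hf⟩ : ∃ f : Module.Dual k (A ⧸ q), f (Ideal.Quotient.mk q (s j)) ≠ 0 := by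
    by_contra! h
    exact hj (Ideal.Quotient.eq_zero_iff_mem.mp ((Module.forall_dual_apply_eq_zero_iff k _).mp h))
  let g : A →ₗ[k] k := f ∘ₗ (Ideal.Quotient.mkₐ k q).toLinearMap
  have heval (v : Fin N → k) : eval v (∑ i, C (g (s i)) * X i) = g (∑ j, v j • s j) := by
    simp [mul_comm]
  refine ⟨∑ i, C (g (s i)) * X i, fun h => hf ?_, fun v hv hmem => hv ?_⟩
  · have := heval (Pi.single j 1)
    rw [h, map_zero] at this
    simpa [g] using this.symm
  · rw [heval]
    exact (congrArg f (Ideal.Quotient.eq_zero_iff_mem.mpr hmem)).trans (map_zero f)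

end GeneralMember

section GeneralQuotient

open Algebra MvPolynomial IsLocalRing

lemma ringKrullDim_le_ringKrullDim_quotient_span_singleton_add_one {R : Type*} [CommRing R]
    [IsNoetherianRing R] [IsLocalRing R] {f : R} (hf : f ∈ maximalIdeal R) :
    ringKrullDim R ≤ ringKrullDim (R ⧸ Ideal.span {f}) + 1 := by
  have := ringKrullDim_le_ringKrullDim_quotient_add_card (R := R) {f}
    (by simpa [ringJacobson_eq_maximalIdeal] using hf)
  rwa [Finset.coe_singleton, Finset.card_singleton, Nat.cast_one] at this

lemma isRegularLocalRing_quotient_span_singleton {R : Type*} [CommRing R]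
    [IsRegularLocalRing R] {f : R} (hf : f ∈ maximalIdeal R) (hf2 : f ∉ maximalIdeal R ^ 2) :
    IsRegularLocalRing (R ⧸ Ideal.span {f}) := by
  have := isRegularLocalRing_quotient_span (f := fun _ : Unit => f) (fun _ => hf) <|
    linearIndependent_unique_iff.mpr fun h =>
      hf2 (((maximalIdeal R).toCotangent_eq_zero ⟨f, hf⟩).mp h)
  rwa [Set.range_const] at this

lemma SeparatesJets.exists_notMem {k A ι : Type*} [CommRing k] [CommRing A] [Algebra k A]
    {s : ι → A} (hs : SeparatesJets k s) (p : Ideal A) [p.IsPrime] : ∃ j, s j ∉ p := by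
  by_contra! h
  exact one_ne_zero (hs p 1 0 fun j => by simpa using Ideal.Quotient.eq_zero_iff_mem.mpr (h j)).1

lemma exists_forall_isRegularLocalRing_quotient {k A : Type*} [Field k] [CommRing A]
    [Algebra k A] [FiniteType k A] {N : ℕ} {s : Fin N → A} (hs : SeparatesJets k s) (a : ℕ)
    (hA : ∀ (q : Ideal A) [q.IsPrime], q.height ≤ a →
      IsRegularLocalRing (Localization.AtPrime q)) :
    ∃ Φ : MvPolynomial (Fin N) k, Φ ≠ 0 ∧ ∀ v : Fin N → k, eval v Φ ≠ 0 →
      ∀ (q : Ideal A) [q.IsPrime] (f : Localization.AtPrime q),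
        f = algebraMap A _ (∑ j, v j • s j) → f ∈ maximalIdeal (Localization.AtPrime q) →
        ringKrullDim (Localization.AtPrime q ⧸ Ideal.span {f}) ≤ a →
        IsRegularLocalRing (Localization.AtPrime q ⧸ Ideal.span {f}) := by
  have : IsNoetherianRing A := FiniteType.isNoetherianRing k A
  have hfin := finite_setOf_not_isRegularLocalRing k a hA
  obtain ⟨Φ, hΦ, hΦq⟩ := exists_forall_notMem_sq hs
  choose Ψ hΨ hΨq using fun q : PrimeSpectrum A =>
    exists_forall_sum_smul_notMem (k := k) (hs.exists_notMem q.asIdeal)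
  refine ⟨Φ * ∏ q ∈ hfin.toFinset, Ψ q, mul_ne_zero hΦ (Finset.prod_ne_zero_iff.mpr
    fun q _ => hΨ q), fun v hv q _ f hfv hf hdim => ?_⟩
  rw [map_mul, map_prod, mul_ne_zero_iff, Finset.prod_ne_zero_iff] at hv
  have hheight : q.height ≤ (a + 1 : ℕ) := by
    have := (ringKrullDim_le_ringKrullDim_quotient_span_singleton_add_one hf).trans
      (add_le_add_left hdim 1)
    rw [IsLocalization.AtPrime.ringKrullDim_eq_height q] at this
    exact_mod_cast this
  have : IsRegularLocalRing (Localization.AtPrime q) := by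
    rcases hheight.lt_or_eq with hlt | heq
    · exact hA q (Order.le_of_lt_add_one (by exact_mod_cast hlt))
    · by_contra hn
      refine hΨq ⟨q, ‹_›⟩ v (hv.2 _ (hfin.mem_toFinset.mpr ⟨by exact_mod_cast heq, hn⟩)) ?_
      rwa [hfv, IsLocalization.AtPrime.to_map_mem_maximal_iff _ q] at hf
  exact isRegularLocalRing_quotient_span_singleton hf (hfv ▸ hΦq v hv.1 q)

end GeneralQuotient

section Dehomogenization

open MvPolynomial

lemma eval₂_smul_of_isHomogeneous {σ R S : Type*} [CommSemiring R] [CommSemiring S]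
    {F : MvPolynomial σ R} {d : ℕ} (hF : F.IsHomogeneous d) (f : R →+* S) (c : S) (v : σ → S) :
    eval₂ f (c • v) F = c ^ d * eval₂ f v F := by
  rw [eval₂_eq, eval₂_eq, Finset.mul_sum]
  refine Finset.sum_congr rfl fun α hα => ?_
  have hdeg : α.degree = d := by
    rw [← hF (mem_support_iff.mp hα), Finsupp.degree_eq_weight_one]; rfl
  simp only [Pi.smul_apply, smul_eq_mul, mul_pow, Finset.prod_mul_distrib]
  rw [Finset.prod_pow_eq_pow_sum, ← Finsupp.degree_apply, hdeg, mul_left_comm]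

variable {k : Type u} [Field k] {n : ℕ}

/-- Dehomogenization `k[x_0, …, x_n] → (k[x_0, …, x_n]_{x_i})₀`, sending `x_j` to `x_j / x_i`. -/
noncomputable def dehomAwayHom (k : Type u) [Field k] {n : ℕ} (i : Fin (n + 1)) :
    MvPolynomial (Fin (n + 1)) k →+*
      HomogeneousLocalization.Away (homogeneousSubmodule (Fin (n + 1)) k) (X i) :=
  eval₂Hom ((HomogeneousLocalization.fromZeroRingHom _ _).comp
      (algebraMap k (homogeneousSubmodule (Fin (n + 1)) k 0)))
    fun j => dehomAway ⟨X j, isHomogeneous_X k j⟩ i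

lemma val_dehomAway_eq_invSelf_pow_mul {d : ℕ} (s : homogeneousSubmodule (Fin (n + 1)) k d)
    (i : Fin (n + 1)) : (dehomAway s i).val =
      IsLocalization.Away.invSelf (X i : MvPolynomial (Fin (n + 1)) k) ^ d *
        algebraMap (MvPolynomial (Fin (n + 1)) k) (Localization.Away (X i)) s.1 := by
  rw [val_dehomAway, Localization.mk_eq_mk', IsLocalization.mk'_eq_iff_eq_mul, map_pow,
    mul_right_comm, ← mul_pow, mul_comm (IsLocalization.Away.invSelf _),
    IsLocalization.Away.mul_invSelf, one_pow, one_mul]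

lemma val_dehomAwayHom (i : Fin (n + 1)) (F : MvPolynomial (Fin (n + 1)) k) :
    letI L := Localization.Away (X i : MvPolynomial (Fin (n + 1)) k)
    letI φ : MvPolynomial (Fin (n + 1)) k →+* L := algebraMap _ L
    letI u : L := IsLocalization.Away.invSelf (X i : MvPolynomial (Fin (n + 1)) k)
    (dehomAwayHom k i F).val = eval₂ (φ.comp C) (u • (φ ∘ X)) F := by
  rw [← HomogeneousLocalization.algebraMap_apply, dehomAwayHom, map_eval₂Hom, coe_eval₂Hom]
  congr 1
  ext j
  exact (val_dehomAway_eq_invSelf_pow_mul _ i).trans (by rw [pow_one]; rfl)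

lemma dehomAway_eq_dehomAwayHom {d : ℕ} (s : homogeneousSubmodule (Fin (n + 1)) k d)
    (i : Fin (n + 1)) : dehomAway s i = dehomAwayHom k i s.1 := by
  apply HomogeneousLocalization.val_injective
  rw [val_dehomAway_eq_invSelf_pow_mul, val_dehomAwayHom, eval₂_smul_of_isHomogeneous s.2,
    ← eval₂_comp_left, eval₂_eta]

/-- Dehomogenization `k[x_0, …, x_n] → Γ(D₊(x_i), 𝒪)`, sending `x_j` to `x_j / x_i`. -/
noncomputable def dehomHom (k : Type u) [Field k] {n : ℕ} (i : Fin (n + 1)) :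
    MvPolynomial (Fin (n + 1)) k →+* Γ(PP n k, (chart k i).1) :=
  (Proj.awayToSection _ _).hom.comp (dehomAwayHom k i)

lemma dehom_eq_dehomHom {d : ℕ} (s : homogeneousSubmodule (Fin (n + 1)) k d) (i : Fin (n + 1)) :
    dehom s i = dehomHom k i s.1 := by
  rw [dehom, dehomAway_eq_dehomAwayHom]; rfl

lemma dehomHom_X_self (i : Fin (n + 1)) : dehomHom k i (X i) = 1 := by
  have h : dehomAway ⟨X i, isHomogeneous_X k i⟩ i = 1 := by
    apply HomogeneousLocalization.val_injective
    rw [val_dehomAway, HomogeneousLocalization.val_one]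
    simp [Localization.mk_self_mk]
  rw [← dehom_eq_dehomHom ⟨X i, isHomogeneous_X k i⟩ i, dehom, h]
  exact map_one _

lemma exists_dehom_eq (i : Fin (n + 1)) (a : Γ(PP n k, (chart k i).1)) :
    ∃ (d : ℕ) (s : homogeneousSubmodule (Fin (n + 1)) k d), dehom s i = a := by
  let e := Proj.basicOpenIsoAway (homogeneousSubmodule (Fin (n + 1)) k) (X i)
    (isHomogeneous_X k i) one_pos
  obtain ⟨d, s, hs, h⟩ := HomogeneousLocalization.Away.mk_surjective _
    (isHomogeneous_X k i) (e.inv.hom a)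
  refine ⟨d, ⟨s, by simpa using hs⟩, ?_⟩
  exact (congrArg e.hom.hom h).trans (Iso.inv_hom_id_apply e a)

lemma dehomHom_surjective (i : Fin (n + 1)) : Function.Surjective (dehomHom k i) := by
  intro a
  obtain ⟨d, s, hs⟩ := exists_dehom_eq i a
  exact ⟨s.1, by rw [← dehom_eq_dehomHom, hs]⟩

lemma awayMap_dehomAway_mul_pow {d : ℕ} (s : homogeneousSubmodule (Fin (n + 1)) k d)
    (i j : Fin (n + 1)) :
    HomogeneousLocalization.awayMap _ (isHomogeneous_X k i) (mul_comm (X i) (X j))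
        (dehomAway s j) *
      HomogeneousLocalization.awayMap _ (isHomogeneous_X k j) rfl
        (dehomAway ⟨X j, isHomogeneous_X k j⟩ i) ^ d =
      HomogeneousLocalization.awayMap _ (isHomogeneous_X k j) rfl (dehomAway s i) := by
  have val_i {e : ℕ} (t : homogeneousSubmodule (Fin (n + 1)) k e) :
      (HomogeneousLocalization.awayMap _ (isHomogeneous_X k j) rfl (dehomAway t i)).val =
        Localization.mk (t.1 * X j ^ e)
          (⟨(X i * X j) ^ e, ⟨e, rfl⟩⟩ : Submonoid.powers (X i * X j)) :=
    HomogeneousLocalization.val_awayMap_mk ..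
  have val_j : (HomogeneousLocalization.awayMap _ (isHomogeneous_X k i) (mul_comm (X i) (X j))
        (dehomAway s j)).val =
      Localization.mk (s.1 * X i ^ d)
        (⟨(X i * X j) ^ d, ⟨d, rfl⟩⟩ : Submonoid.powers (X i * X j)) :=
    HomogeneousLocalization.val_awayMap_mk ..
  apply HomogeneousLocalization.val_injective
  rw [HomogeneousLocalization.val_mul, HomogeneousLocalization.val_pow, val_i, val_i, val_j,
    Localization.mk_pow, Localization.mk_mul, Localization.mk_eq_mk_iff, Localization.r_iff_exists]
  refine ⟨1, ?_⟩
  simp only [OneMemClass.coe_one, Submonoid.coe_mul, SubmonoidClass.coe_pow, one_mul]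
  ring

lemma map_awayToSection_eq {f g x : MvPolynomial (Fin (n + 1)) k} {e : ℕ}
    (hg : g ∈ homogeneousSubmodule (Fin (n + 1)) k e) (hx : x = f * g) {V : (PP n k).Opens}
    (hf : V ≤ Proj.basicOpen _ f) (hV : V ≤ Proj.basicOpen _ x)
    (a : HomogeneousLocalization.Away (homogeneousSubmodule (Fin (n + 1)) k) f) :
    (PP n k).presheaf.map (homOfLE hf).op ((Proj.awayToSection _ f).hom a) =
      (PP n k).presheaf.map (homOfLE hV).op
        ((Proj.awayToSection _ x).hom (HomogeneousLocalization.awayMap _ hg hx a)) := by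
  have h := congr(($(Proj.awayMap_awayToSection _ hg hx) ≫
    (PP n k).presheaf.map (homOfLE hV).op).hom a)
  rw [Category.assoc, Category.assoc, ← Functor.map_comp] at h
  exact h.symm

lemma map_dehom_mul_pow {d : ℕ} (s : homogeneousSubmodule (Fin (n + 1)) k d) {i j : Fin (n + 1)}
    {V : (PP n k).Opens} (hi : V ≤ (chart k i).1) (hj : V ≤ (chart k j).1) :
    ((PP n k).presheaf.map (homOfLE hj).op).hom (dehom s j) *
      ((PP n k).presheaf.map (homOfLE hi).op).hom (dehomHom k i (X j)) ^ d =
      ((PP n k).presheaf.map (homOfLE hi).op).hom (dehom s i) := by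
  have hV : V ≤ Proj.basicOpen _ (X i * X j) := by
    rw [Proj.basicOpen_mul]; exact le_inf hi hj
  have hXj : dehomHom k i (X j) = dehom ⟨X j, isHomogeneous_X k j⟩ i :=
    (dehom_eq_dehomHom ⟨X j, isHomogeneous_X k j⟩ i).symm
  have map_i (a) := map_awayToSection_eq (isHomogeneous_X k j) rfl hi hV a
  have map_j (a) := map_awayToSection_eq (isHomogeneous_X k i) (mul_comm (X i) (X j)) hj hV a
  rw [hXj]
  refine (congrArg₂ (· * · ^ d) (map_j _) (map_i _)).trans (.trans ?_ (map_i _).symm)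
  rw [← map_pow, ← map_pow, ← map_mul, ← map_mul, awayMap_dehomAway_mul_pow]

end Dehomogenization

section ClosedSubscheme

variable {X Y : Scheme.{u}}

lemma app_eq_zero_iff_appLE_top (f : X ⟶ Y) {U : Y.Opens} (h : ⊤ ≤ f ⁻¹ᵁ U) (z : Γ(Y, U)) :
    (f.app U).hom z = 0 ↔ (f.appLE U ⊤ h).hom z = 0 := by
  constructor
  · intro hz
    rw [Scheme.Hom.appLE, CommRingCat.hom_comp, RingHom.comp_apply, hz, map_zero]
  · intro hz
    rw [f.app_eq_appLE, ← f.appLE_map h (homOfLE le_top).op, CommRingCat.hom_comp,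
      RingHom.comp_apply, hz, map_zero]

/-- The closed subscheme of an affine open `W` of `X` cut out by an ideal, as a morphism to `X`. -/
noncomputable def closedSubschemeι {W : X.Opens} (hW : IsAffineOpen W) (𝔞 : Ideal Γ(X, W)) :
    Spec (.of (Γ(X, W) ⧸ 𝔞)) ⟶ X :=
  Spec.map (CommRingCat.ofHom (Ideal.Quotient.mk 𝔞)) ≫ hW.fromSpec

lemma top_le_closedSubschemeι_preimage {W : X.Opens} (hW : IsAffineOpen W)
    (𝔞 : Ideal Γ(X, W)) : ⊤ ≤ closedSubschemeι hW 𝔞 ⁻¹ᵁ W := by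
  intro x _
  have : hW.fromSpec (Spec.map (CommRingCat.ofHom (Ideal.Quotient.mk 𝔞)) x) ∈
    Set.range hW.fromSpec := ⟨_, rfl⟩
  rw [hW.range_fromSpec] at this
  exact this

lemma closedSubschemeι_appLE {W : X.Opens} (hW : IsAffineOpen W) (𝔞 : Ideal Γ(X, W)) :
    (closedSubschemeι hW 𝔞).appLE W ⊤ (top_le_closedSubschemeι_preimage hW 𝔞) =
      CommRingCat.ofHom (Ideal.Quotient.mk 𝔞) ≫ (Scheme.ΓSpecIso _).inv := by
  have : ⊤ ≤ Spec.map (CommRingCat.ofHom (Ideal.Quotient.mk 𝔞)) ⁻¹ᵁ (hW.fromSpec ⁻¹ᵁ W) :=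
    top_le_closedSubschemeι_preimage hW 𝔞
  rw [Scheme.ΓSpecIso_inv_naturality]
  trans hW.fromSpec.app W ≫ (Spec.map (CommRingCat.ofHom (Ideal.Quotient.mk 𝔞))).appLE _ ⊤ this
  · exact Scheme.Hom.comp_appLE _ _ _ _ _
  · rw [hW.fromSpec_app_self, Category.assoc, Scheme.Hom.map_appLE, Scheme.Hom.appTop,
      Scheme.Hom.app_eq_appLE]
    rfl

lemma closedSubschemeι_appLE_eq_zero_iff {W : X.Opens} (hW : IsAffineOpen W) (𝔞 : Ideal Γ(X, W))
    (z : Γ(X, W)) :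
    ((closedSubschemeι hW 𝔞).appLE W ⊤ (top_le_closedSubschemeι_preimage hW 𝔞)).hom z = 0 ↔
      z ∈ 𝔞 := by
  have hinj : Function.Injective (Scheme.ΓSpecIso (.of (Γ(X, W) ⧸ 𝔞))).inv.hom :=
    (Scheme.ΓSpecIso (.of (Γ(X, W) ⧸ 𝔞))).symm.commRingCatIsoToRingEquiv.injective
  rw [closedSubschemeι_appLE, CommRingCat.hom_comp, RingHom.comp_apply]
  exact (map_eq_zero_iff _ hinj).trans Ideal.Quotient.eq_zero_iff_mem

lemma ideal_ker_closedSubschemeι_le (W : X.affineOpens) (𝔞 : Ideal Γ(X, W.1)) :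
    (closedSubschemeι W.2 𝔞).ker.ideal W ≤ 𝔞 := fun z hz =>
  (closedSubschemeι_appLE_eq_zero_iff W.2 𝔞 z).mp ((app_eq_zero_iff_appLE_top _
    (top_le_closedSubschemeι_preimage W.2 𝔞) z).mp (Scheme.Hom.ideal_ker_le _ W hz))

end ClosedSubscheme

section Hypersurface

open MvPolynomial

variable {k : Type u} [Field k] {n : ℕ}

lemma iSup_chart : ⨆ i, (chart k (n := n) i).1 = ⊤ := by
  refine Proj.iSup_basicOpen_eq_top' (homogeneousSubmodule (Fin (n + 1)) k)
    (fun i => (X i : MvPolynomial (Fin (n + 1)) k)) (fun i => ⟨1, isHomogeneous_X k i⟩) ?_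
  rw [_root_.eq_top_iff]
  intro p _
  induction p using MvPolynomial.induction_on with
  | C a =>
    let c : homogeneousSubmodule (Fin (n + 1)) k 0 := ⟨C a, isHomogeneous_C _ a⟩
    exact Subalgebra.algebraMap_mem (Algebra.adjoin (homogeneousSubmodule (Fin (n + 1)) k 0) _) c
  | add p q hp hq => exact add_mem (hp trivial) (hq trivial)
  | mul_X p i hp => exact mul_mem (hp trivial) (Algebra.subset_adjoin ⟨i, rfl⟩)

lemma exists_mem_chart (x : PP n k) : ∃ i, x ∈ (chart k i).1 :=
  TopologicalSpace.Opens.mem_iSup.mp (iSup_chart (k := k) (n := n) ▸ trivial)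

lemma isUnit_map_dehomHom_X {i j : Fin (n + 1)} {V : (PP n k).Opens} (hi : V ≤ (chart k i).1)
    (hj : V ≤ (chart k j).1) :
    IsUnit (((PP n k).presheaf.map (homOfLE hi).op).hom (dehomHom k i (X j))) := by
  have := map_dehom_mul_pow ⟨X i, isHomogeneous_X k i⟩ hi hj
  rw [dehom_eq_dehomHom _ i, dehomHom_X_self, map_one, pow_one] at this
  exact .of_mul_eq_one_right _ this

variable {d : ℕ} {s : homogeneousSubmodule (Fin (n + 1)) k d}

lemma mem_globalSections_ker_of_appLE_eq_zero {T : Scheme.{u}} (g : T ⟶ PP n k) [QuasiCompact g]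
    {i : Fin (n + 1)} (hi : ⊤ ≤ g ⁻¹ᵁ (chart k i).1)
    (h : (g.appLE (chart k i).1 ⊤ hi).hom (dehom s i) = 0) : s ∈ globalSections g.ker d := by
  intro j
  rw [Scheme.Hom.ker_apply, RingHom.mem_ker]
  have e : g ⁻¹ᵁ (chart k j).1 ≤ g ⁻¹ᵁ ((chart k i).1 ⊓ (chart k j).1) :=
    fun x hx => ⟨hi trivial, hx⟩
  have h1 := congr((g.appLE _ _ e).hom $(map_dehom_mul_pow s
    (inf_le_left : (chart k i).1 ⊓ (chart k j).1 ≤ _) inf_le_right))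
  rw [map_mul, map_pow, ← RingHom.comp_apply, ← CommRingCat.hom_comp, g.map_appLE,
    ← g.app_eq_appLE] at h1
  have h2 : (g.appLE _ _ e).hom (((PP n k).presheaf.map (homOfLE inf_le_left).op).hom
      (dehom s i)) = 0 := by
    rw [← RingHom.comp_apply, ← CommRingCat.hom_comp, g.map_appLE,
      ← g.appLE_map hi (homOfLE le_top).op, CommRingCat.hom_comp, RingHom.comp_apply, h, map_zero]
  rw [h2] at h1
  exact (((isUnit_map_dehomHom_X inf_le_left inf_le_right).map (g.appLE _ _ e).hom).pow
    d).mul_left_eq_zero.mp h1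

lemma globalSections_mono {I J : (PP n k).IdealSheafData} (h : I ≤ J) :
    globalSections I d ≤ globalSections J d := fun _ hs i => h _ (hs i)

variable (s)

lemma mem_globalSections_hypersurfaceIdeal : s ∈ globalSections (hypersurfaceIdeal s) d := by
  -- Only finite infima of ideal sheaves are computed chart by chart, so the infimum defining
  -- `hypersurfaceIdeal s` is bounded below by a finite one that still has `s` as a section.
  let L : (PP n k).IdealSheafData :=
    ⨅ i, (closedSubschemeι (chart k i).2 (Ideal.span {dehom s i})).ker
  have hL : L ≤ hypersurfaceIdeal s := by
    refine le_sInf fun J hJ => Scheme.IdealSheafData.le_of_iSup_eq_top _ iSup_chart fun i => ?_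
    refine ((iInf_le _ i : L ≤ _) (chart k i)).trans ((ideal_ker_closedSubschemeι_le _ _).trans ?_)
    rw [Ideal.span_singleton_le_iff_mem]
    exact hJ i
  refine globalSections_mono hL fun j => ?_
  rw [Scheme.IdealSheafData.ideal_iInf, iInf_apply, Submodule.mem_iInf]
  exact fun i => mem_globalSections_ker_of_appLE_eq_zero _ (top_le_closedSubschemeι_preimage _ _)
    ((closedSubschemeι_appLE_eq_zero_iff _ _ _).mpr (Ideal.mem_span_singleton_self _)) j

lemma hypersurfaceIdeal_le_iff {J : (PP n k).IdealSheafData} :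
    hypersurfaceIdeal s ≤ J ↔ s ∈ globalSections J d :=
  ⟨fun h => globalSections_mono h (mem_globalSections_hypersurfaceIdeal s),
    fun h => sInf_le h⟩

section Comap

variable {X : Scheme.{u}} (f : X ⟶ PP n k) (i : Fin (n + 1)) (W : X.affineOpens)
  (hW : W.1 ≤ f ⁻¹ᵁ (chart k i).1)

lemma ideal_comap_hypersurfaceIdeal_le :
    ((hypersurfaceIdeal s).comap f).ideal W ≤
      Ideal.span {(f.appLE (chart k i).1 W.1 hW).hom (dehom s i)} := by
  set z := (f.appLE (chart k i).1 W.1 hW).hom (dehom s i)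
  let g := closedSubschemeι W.2 (Ideal.span {z})
  suffices (hypersurfaceIdeal s).comap f ≤ g.ker from
    (this W).trans (ideal_ker_closedSubschemeι_le W _)
  rw [← Scheme.IdealSheafData.le_map_iff_comap_le, Scheme.IdealSheafData.map_ker,
    hypersurfaceIdeal_le_iff]
  have hg : ⊤ ≤ g ⁻¹ᵁ W.1 := top_le_closedSubschemeι_preimage W.2 _
  refine mem_globalSections_ker_of_appLE_eq_zero (g ≫ f) (i := i) (fun x hx => hW (hg hx)) ?_
  rw [← Scheme.Hom.appLE_comp_appLE _ _ _ W.1 ⊤ hW hg, CommRingCat.hom_comp, RingHom.comp_apply]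
  exact (closedSubschemeι_appLE_eq_zero_iff _ _ _).mpr (Ideal.mem_span_singleton_self _)

lemma appLE_dehom_mem_ideal_comap_hypersurfaceIdeal :
    (f.appLE (chart k i).1 W.1 hW).hom (dehom s i) ∈
      ((hypersurfaceIdeal s).comap f).ideal W := by
  set K := (hypersurfaceIdeal s).comap f
  have hs : ((K.subschemeι ≫ f).app (chart k i).1).hom (dehom s i) = 0 :=
    Scheme.Hom.ideal_ker_le _ _
      ((hypersurfaceIdeal_le_iff s).mp ((hypersurfaceIdeal s).le_map_comap f) i)
  have e : K.subschemeι ⁻¹ᵁ W.1 ≤ (K.subschemeι ≫ f) ⁻¹ᵁ (chart k i).1 := fun x hx => hW hx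
  have happ : f.appLE (chart k i).1 W.1 hW ≫ K.subschemeι.app W.1 =
      (K.subschemeι ≫ f).app (chart k i).1 ≫ K.subscheme.presheaf.map (homOfLE e).op := by
    rw [Scheme.Hom.app_eq_appLE, Scheme.Hom.app_eq_appLE, Scheme.Hom.appLE_comp_appLE,
      Scheme.Hom.appLE_map]
  rw [← K.ker_subschemeι_app, RingHom.mem_ker, ← RingHom.comp_apply, ← CommRingCat.hom_comp, happ,
    CommRingCat.hom_comp, RingHom.comp_apply, hs, map_zero]

lemma ideal_comap_hypersurfaceIdeal :
    ((hypersurfaceIdeal s).comap f).ideal W =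
      Ideal.span {(f.appLE (chart k i).1 W.1 hW).hom (dehom s i)} :=
  (ideal_comap_hypersurfaceIdeal_le s f i W hW).antisymm
    ((Ideal.span_singleton_le_iff_mem _).mpr
      (appLE_dehom_mem_ideal_comap_hypersurfaceIdeal s f i W hW))

end Comap

end Hypersurface

section Stalk

open IsLocalRing

lemma ker_eq_map_ker_of_isLocalization {A B S T : Type*} [CommRing A] [CommRing B] [CommRing S]
    [CommRing T] [Algebra A S] [Algebra B T] (M : Submonoid A) (N : Submonoid B)
    [IsLocalization M S] [IsLocalization N T] {φ : A →+* B} (hφ : Function.Surjective φ)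
    {ψ : S →+* T} [IsLocalHom ψ] (h : ∀ a, ψ (algebraMap A S a) = algebraMap B T (φ a)) :
    RingHom.ker ψ = (RingHom.ker φ).map (algebraMap A S) := by
  apply le_antisymm
  · intro y hy
    obtain ⟨⟨a, b⟩, hab⟩ := IsLocalization.surj M y
    have hφa : algebraMap B T (φ a) = 0 := by
      rw [← h, ← hab, map_mul, RingHom.mem_ker.mp hy, zero_mul]
    obtain ⟨m, hma⟩ := (IsLocalization.map_eq_zero_iff N T _).mp hφa
    obtain ⟨m', hm'⟩ := hφ m
    have hm'unit : IsUnit (algebraMap A S m') :=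
      isUnit_of_map_unit ψ _ (by rw [h, hm']; exact IsLocalization.map_units T m)
    have hma' : m' * a ∈ RingHom.ker φ := by rw [RingHom.mem_ker, map_mul, hm', hma]
    have hmap := Ideal.mem_map_of_mem (algebraMap A S) hma'
    rwa [map_mul, ← hab, Ideal.unit_mul_mem_iff_mem _ hm'unit,
      Ideal.mul_unit_mem_iff_mem _ (IsLocalization.map_units S b)] at hmap
  · rw [Ideal.map_le_iff_le_comap]
    intro x hx
    rw [Ideal.mem_comap, RingHom.mem_ker, h, RingHom.mem_ker.mp hx, map_zero]

lemma ker_stalkMap_of_isClosedImmersion {X Y : Scheme.{u}} (p : Y ⟶ X) [IsClosedImmersion p]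
    (y : Y) (W : X.affineOpens) (hy : p y ∈ W.1) :
    RingHom.ker (p.stalkMap y).hom = (p.ker.ideal W).map (X.presheaf.germ W.1 _ hy).hom := by
  let := X.presheaf.algebra_section_stalk ⟨p y, hy⟩
  let := Y.presheaf.algebra_section_stalk (U := p ⁻¹ᵁ W.1) ⟨y, hy⟩
  have := W.2.isLocalization_stalk ⟨p y, hy⟩
  have := (W.2.preimage p).isLocalization_stalk ⟨y, hy⟩
  rw [Scheme.Hom.ker_apply]
  exact ker_eq_map_ker_of_isLocalization (W.2.primeIdealOf ⟨p y, hy⟩).asIdeal.primeCompl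
    ((W.2.preimage p).primeIdealOf ⟨y, hy⟩).asIdeal.primeCompl (p.app_surjective W.1 W.2)
    (p.germ_stalkMap_apply W.1 y hy)

variable {k : Type u} [Field k] {n d : ℕ} {X : Scheme.{u}} (f : X ⟶ PP n k)
  (s : MvPolynomial.homogeneousSubmodule (Fin (n + 1)) k d)

/-- The closed immersion of `X ∩ H` into `X`. -/
noncomputable def interHypersurfaceι : interHypersurface f s ⟶ X := pullback.fst _ _

instance : IsClosedImmersion (interHypersurfaceι f s) :=
  inferInstanceAs (IsClosedImmersion (pullback.fst f (hypersurfaceIdeal s).subschemeι))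

variable (i : Fin (n + 1)) (W : X.affineOpens) (hW : W.1 ≤ f ⁻¹ᵁ (chart k i).1)
  (y : (interHypersurface f s : Scheme.{u})) (hy : interHypersurfaceι f s y ∈ W.1)

lemma ker_stalkMap_interHypersurfaceι :
    RingHom.ker ((interHypersurfaceι f s).stalkMap y).hom =
      Ideal.span {(X.presheaf.germ W.1 _ hy).hom
        ((f.appLE (chart k i).1 W.1 hW).hom (dehom s i))} := by
  have hker : (interHypersurfaceι f s).ker = (hypersurfaceIdeal s).comap f := rfl
  rw [ker_stalkMap_of_isClosedImmersion _ y W hy, hker, ideal_comap_hypersurfaceIdeal s f i W hW,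
    Ideal.map_span, Set.image_singleton]

lemma germ_appLE_dehom_mem_maximalIdeal :
    (X.presheaf.germ W.1 _ hy).hom ((f.appLE (chart k i).1 W.1 hW).hom (dehom s i)) ∈
      maximalIdeal (X.presheaf.stalk (interHypersurfaceι f s y)) := by
  rw [← Ideal.span_singleton_le_iff_mem, ← ker_stalkMap_interHypersurfaceι f s i W hW y hy]
  exact le_maximalIdeal (RingHom.ker_ne_top _)

/-- The local ring of `X ∩ H` at `y` is that of `X` modulo the local equation of `H`. -/
noncomputable def stalkInterHypersurfaceEquiv :
    (X.presheaf.stalk (interHypersurfaceι f s y) ⧸ Ideal.span {(X.presheaf.germ W.1 _ hy).hom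
      ((f.appLE (chart k i).1 W.1 hW).hom (dehom s i))}) ≃+*
      (interHypersurface f s).presheaf.stalk y :=
  (Ideal.quotEquivOfEq (ker_stalkMap_interHypersurfaceι f s i W hW y hy).symm).trans
    (RingHom.quotientKerEquivOfSurjective ((interHypersurfaceι f s).stalkMap_surjective y))

end Stalk

section GlobalSections

open MvPolynomial

variable {k : Type u} [Field k] {n : ℕ}

lemma mem_globalSections_of_eq_mul {I : (PP n k).IdealSheafData} {d e : ℕ}
    {s : homogeneousSubmodule (Fin (n + 1)) k d} {g : homogeneousSubmodule (Fin (n + 1)) k e}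
    (hg : g ∈ globalSections I e) {h : MvPolynomial (Fin (n + 1)) k} (hs : s.1 = g.1 * h) :
    s ∈ globalSections I d := fun i => by
  rw [dehom_eq_dehomHom, hs, map_mul, ← dehom_eq_dehomHom]
  exact Ideal.mul_mem_right _ _ (hg i)

lemma basicOpen_dehom_le {d : ℕ} (s : homogeneousSubmodule (Fin (n + 1)) k d) (j : Fin (n + 1)) :
    (PP n k).basicOpen (dehom s j) ≤ Proj.basicOpen _ s.1 := by
  intro x hx
  have hxj : x ∈ (chart k j).1 := (PP n k).basicOpen_le _ hx
  rw [Scheme.mem_basicOpen _ _ _ hxj] at hx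
  let 𝒜 := homogeneousSubmodule (Fin (n + 1)) k
  let p := x.asHomogeneousIdeal.toIdeal
  have : p.IsPrime := x.isPrime
  have hp : Submonoid.powers (X j) ≤ p.primeCompl := Submonoid.powers_le.mpr hxj
  let φ := HomogeneousLocalization.mapId 𝒜 hp
  have hgerm : IsUnit ((Proj.stalkIso' 𝒜 x).symm (φ (dehomAway s j))) := by
    have h := congr($(ProjectiveSpectrum.Proj.awayToSection_germ 𝒜 (X j) x hxj).hom
      (dehomAway s j))
    rw [← show _ = (Proj.stalkIso' 𝒜 x).symm (φ (dehomAway s j)) from h]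
    exact hx
  have hφ : IsUnit (φ (dehomAway s j)) := by
    rwa [isUnit_map_iff] at hgerm
  have hval : IsUnit (Localization.mk s.1 (⟨X j ^ d, hp ⟨d, rfl⟩⟩ : p.primeCompl)) :=
    hφ.map (algebraMap _ (Localization p.primeCompl))
  rwa [Localization.mk_eq_mk', IsLocalization.AtPrime.isUnit_mk'_iff] at hval

lemma exists_pow_mul_mem_ideal (I : (PP n k).IdealSheafData) {d : ℕ}
    (s : homogeneousSubmodule (Fin (n + 1)) k d) (m j : Fin (n + 1))
    (hs : dehom s m ∈ I.ideal (chart k m)) :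
    ∃ r, dehomHom k j (X m) ^ r * dehom s j ∈ I.ideal (chart k j) := by
  rw [← dehom_eq_dehomHom ⟨X m, isHomogeneous_X k m⟩]
  set t := dehom (⟨X m, isHomogeneous_X k m⟩ : homogeneousSubmodule (Fin (n + 1)) k 1) j
  let B : (PP n k).affineOpens := (PP n k).affineBasicOpen t
  have hBj : B.1 ≤ (chart k j).1 := (PP n k).basicOpen_le t
  have hBm : B.1 ≤ (chart k m).1 := basicOpen_dehom_le _ j
  have hB : ((PP n k).presheaf.map (homOfLE hBj).op).hom (dehom s j) ∈ I.ideal B := by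
    rw [← map_dehom_mul_pow s hBj hBm]
    exact Ideal.mul_mem_right _ _ (I.ideal_le_comap_ideal (U := B) (V := chart k m) hBm hs)
  rw [← I.map_ideal_basicOpen] at hB
  have := (chart k j).2.isLocalization_basicOpen t
  obtain ⟨_, ⟨r, rfl⟩, hr⟩ := (IsLocalization.algebraMap_mem_map_algebraMap_iff (.powers t)
    Γ(PP n k, (PP n k).basicOpen t) _ _).mp hB
  exact ⟨r, hr⟩

lemma exists_globalSections_mem_basicOpen (I : (PP n k).IdealSheafData) (x : PP n k)
    (hx : x ∉ I.support) : ∃ (m : Fin (n + 1)) (e : ℕ)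
      (g : homogeneousSubmodule (Fin (n + 1)) k e), g ∈ globalSections I e ∧
      x ∈ (PP n k).basicOpen (dehom g m) := by
  obtain ⟨m, hm⟩ := exists_mem_chart x
  rw [Scheme.IdealSheafData.mem_support_iff_of_mem (U := chart k m) hm,
    Scheme.mem_zeroLocus_iff] at hx
  push Not at hx
  obtain ⟨a, haI, hxa⟩ := hx
  obtain ⟨e, g, rfl⟩ := exists_dehom_eq m a
  -- On each chart a power of `X m` clears the denominators of `g`, so one power suffices for all.
  choose r hr using fun j => exists_pow_mul_mem_ideal I g m j haI
  let R := Finset.univ.sup r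
  let g' : homogeneousSubmodule (Fin (n + 1)) k (e + R) :=
    ⟨g.1 * X m ^ R, IsHomogeneous.mul g.2 (by simpa using (isHomogeneous_X k m).pow R)⟩
  refine ⟨m, e + R, g', fun j => ?_, ?_⟩
  · have hle : r j ≤ R := Finset.le_sup (Finset.mem_univ j)
    rw [dehom_eq_dehomHom, map_mul, map_pow, ← dehom_eq_dehomHom, ← Nat.sub_add_cancel hle,
      pow_add, mul_comm, mul_assoc]
    exact Ideal.mul_mem_left _ _ (hr j)
  · have hg' : dehom g' m = dehom g m := by
      rw [dehom_eq_dehomHom, map_mul, map_pow, dehomHom_X_self, one_pow, mul_one,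
        ← dehom_eq_dehomHom]
    rwa [hg']

end GlobalSections

section Jets

open Algebra

lemma derivation_eq_zero_of_adjoin_eq_top {k B A M σ : Type*} [CommRing k] [CommRing B]
    [CommRing A] [AddCommGroup M] [Algebra k B] [Algebra k A] [Algebra B A] [IsScalarTower k B A]
    [Module k M] [Module A M] [IsScalarTower k A M] [FormallyUnramified B A] {t : σ → B}
    (ht : adjoin k (Set.range t) = ⊤) {D : Derivation k A M}
    (hD : ∀ j, D (algebraMap B A (t j)) = 0) : D = 0 := by
  let _ : Module B M := .compHom M (algebraMap B A)
  have : IsScalarTower B A M := .of_compHom _ _ _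
  have : IsScalarTower k B M := .of_algebraMap_smul fun r m => by
    rw [← algebraMap_smul A (algebraMap k B r) m, ← IsScalarTower.algebraMap_apply,
      algebraMap_smul]
  have hDB : D.compAlgebraMap B = 0 :=
    Derivation.ext_of_adjoin_eq_top _ ht fun _ ⟨j, hj⟩ => hj ▸ hD j
  let E : Derivation B A M := Derivation.mk'
    { toFun := D
      map_add' := D.map_add
      map_smul' := fun b x => by
        have hb : D (algebraMap B A b) = 0 := congr($hDB b)
        rw [Algebra.smul_def, D.leibniz, hb, smul_zero, add_zero, algebraMap_smul,
          RingHom.id_apply] } D.leibniz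
  ext x
  change E x = 0
  rw [← E.liftKaehlerDifferential_comp_D, Subsingleton.elim (KaehlerDifferential.D B A x) 0,
    map_zero]

lemma jet_eq_zero_of_mul_adjoin_eq_top {k B A K σ : Type*} [CommRing k] [CommRing B] [CommRing A]
    [CommRing K] [IsDomain K] [Algebra k B] [Algebra k A] [Algebra B A] [IsScalarTower k B A]
    [Algebra A K] [Algebra k K] [IsScalarTower k A K] [FormallyUnramified B A] {t : σ → B}
    (ht : adjoin k (Set.range t) = ⊤) {g : A} (hg : IsUnit g) {c : K} {D : Derivation k A K}
    (h₀ : c * algebraMap A K g + D g = 0)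
    (h : ∀ j, c * algebraMap A K (g * algebraMap B A (t j)) + D (g * algebraMap B A (t j)) = 0) :
    c = 0 ∧ D = 0 := by
  have hgK : algebraMap A K g ≠ 0 := (hg.map (algebraMap A K)).ne_zero
  have hD : D = 0 := derivation_eq_zero_of_adjoin_eq_top ht fun j => by
    have hj := h j
    rw [D.leibniz, map_mul, smul_def, smul_def] at hj
    have hgD : algebraMap A K g * D (algebraMap B A (t j)) = 0 := by
      linear_combination hj - algebraMap A K (algebraMap B A (t j)) * h₀
    exact (mul_eq_zero.mp hgD).resolve_left hgK
  rw [hD, Derivation.zero_apply, add_zero] at h₀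
  exact ⟨(mul_eq_zero.mp h₀).resolve_right hgK, hD⟩

lemma separatesJets_of_mul_mem_span {k B A ι σ : Type*} [CommRing k] [CommRing B] [CommRing A]
    [Algebra k B] [Algebra k A] [Algebra B A] [IsScalarTower k B A] [FormallyUnramified B A]
    {t : σ → B} (ht : adjoin k (Set.range t) = ⊤) {g : A} (hg : IsUnit g) {s : ι → A}
    (hgs : g ∈ Submodule.span k (Set.range s))
    (hgts : ∀ j, g * algebraMap B A (t j) ∈ Submodule.span k (Set.range s)) :
    SeparatesJets k s := by
  intro p _ c D h
  let L : A →ₗ[k] A ⧸ p :=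
    LinearMap.mulLeft k c ∘ₗ (Ideal.Quotient.mkₐ k p).toLinearMap + D.toLinearMap
  have hL : Submodule.span k (Set.range s) ≤ LinearMap.ker L :=
    Submodule.span_le.mpr (Set.range_subset_iff.mpr h)
  exact jet_eq_zero_of_mul_adjoin_eq_top ht hg (hL hgs) fun j => hL (hgts j)

end Jets

section HoldsGenerically

open MvPolynomial

/-- The property `P` holds for the vectors of `V` outside the zero locus of some nonzero polynomial
in the coordinates; the polynomial need not be homogeneous. -/
def HoldsGenerically (k : Type*) {V : Type*} [Field k] [AddCommGroup V] [Module k V]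
    [Module.Finite k V] (P : V → Prop) : Prop :=
  ∃ Φ : MvPolynomial (Fin (Module.finrank k V)) k, Φ ≠ 0 ∧
    ∀ s : V, eval ((Module.finBasis k V).repr s) Φ ≠ 0 → P s

namespace HoldsGenerically

variable {k V : Type*} [Field k] [AddCommGroup V] [Module k V] [Module.Finite k V] {P Q : V → Prop}

lemma of_forall (h : ∀ s, P s) : HoldsGenerically k P := ⟨1, one_ne_zero, fun s _ => h s⟩

lemma mono (hP : HoldsGenerically k P) (h : ∀ s, P s → Q s) : HoldsGenerically k Q :=
  let ⟨Φ, hΦ, H⟩ := hP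
  ⟨Φ, hΦ, fun s hs => h s (H s hs)⟩

lemma and (hP : HoldsGenerically k P) (hQ : HoldsGenerically k Q) :
    HoldsGenerically k fun s => P s ∧ Q s :=
  let ⟨Φ, hΦ, hΦP⟩ := hP
  let ⟨Ψ, hΨ, hΨQ⟩ := hQ
  ⟨Φ * Ψ, mul_ne_zero hΦ hΨ, fun s hs => by
    rw [map_mul, mul_ne_zero_iff] at hs
    exact ⟨hΦP s hs.1, hΨQ s hs.2⟩⟩

end HoldsGenerically

lemma exists_eval_smul_ne_zero {σ k : Type*} [Field k] [Infinite k] {Φ : MvPolynomial σ k} {e : ℕ}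
    {v : σ → k} (hv : eval v (homogeneousComponent e Φ) ≠ 0) :
    ∃ c : k, c ≠ 0 ∧ eval (c • v) Φ ≠ 0 := by
  let q : Polynomial k := ∑ i ∈ Finset.range (Φ.totalDegree + 1),
    Polynomial.monomial i (eval v (homogeneousComponent i Φ))
  have hq (c : k) : q.eval c = eval (c • v) Φ := by
    conv_rhs => rw [← sum_homogeneousComponent Φ, map_sum]
    rw [Polynomial.eval_finsetSum]
    refine Finset.sum_congr rfl fun i _ => ?_
    rw [Polynomial.eval_monomial, mul_comm]
    exact (eval₂_smul_of_isHomogeneous (homogeneousComponent_isHomogeneous i Φ) (.id k) c v).symm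
  have hqe : q.coeff e = eval v (homogeneousComponent e Φ) := by
    simp only [q, Polynomial.finsetSum_coeff, Polynomial.coeff_monomial, Finset.sum_ite_eq',
      Finset.mem_range, ite_eq_left_iff, not_lt]
    intro he
    rw [homogeneousComponent_eq_zero _ _ he, map_zero]
  have hq₀ : q * Polynomial.X ≠ 0 :=
    mul_ne_zero (fun h => hv (by rw [← hqe, h, Polynomial.coeff_zero])) Polynomial.X_ne_zero
  obtain ⟨c, hc⟩ : ∃ c, (q * Polynomial.X).eval c ≠ 0 := by
    by_contra! h
    exact hq₀ (Polynomial.funext fun c => by rw [h c, Polynomial.eval_zero])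
  rw [Polynomial.eval_mul, Polynomial.eval_X, hq] at hc
  exact ⟨c, right_ne_zero_of_mul hc, left_ne_zero_of_mul hc⟩

variable {k : Type u} [Field k]

lemma rationalPoint_mem_basicOpen_iff {ι : Type} {c : ι → k} (hc : c ≠ 0) {d : ℕ}
    {F : MvPolynomial ι k} (hF : F.IsHomogeneous d) :
    rationalPoint c hc ∈ Proj.basicOpen (homogeneousSubmodule ι k) F ↔ eval c F ≠ 0 := by
  rw [Proj.mem_basicOpen]
  exact (mem_rationalPoint_iff c hc d F hF).not

variable [Infinite k]

lemma nonempty_basicOpen {ι : Type} [Nonempty ι] {d : ℕ} {F : MvPolynomial ι k}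
    (hF : F.IsHomogeneous d) (hF₀ : F ≠ 0) :
    (Proj.basicOpen (homogeneousSubmodule ι k) F : Set (ProjSpace ι k)).Nonempty := by
  obtain ⟨j⟩ := ‹Nonempty ι›
  obtain ⟨v, hv⟩ : ∃ v, eval v (F * X j) ≠ 0 := by
    by_contra! h
    exact mul_ne_zero hF₀ (X_ne_zero j) (MvPolynomial.funext fun v => by rw [h v, map_zero])
  rw [map_mul, eval_X] at hv
  have hv₀ : v ≠ 0 := fun h => right_ne_zero_of_mul hv (congrFun h j)
  exact ⟨rationalPoint v hv₀,
    (rationalPoint_mem_basicOpen_iff hv₀ hF).mpr (left_ne_zero_of_mul hv)⟩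

lemma HoldsGenerically.exists_linearSystem_opens {n d : ℕ} {I : (PP n k).IdealSheafData}
    [Nontrivial (globalSections I d)] {P : globalSections I d → Prop} (hP : HoldsGenerically k P)
    (hsmul : ∀ (c : k) s, c ≠ 0 → P (c • s) → P s) :
    ∃ U : (linearSystem I d).Opens, (U : Set (linearSystem I d)).Nonempty ∧
      ∀ (s : globalSections I d) (hs : s ≠ 0), linearSystemPoint s hs ∈ U → P s := by
  obtain ⟨Φ, hΦ, H⟩ := hP
  obtain ⟨e, he⟩ : ∃ e, homogeneousComponent e Φ ≠ 0 := by
    by_contra! h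
    exact hΦ (by rw [← sum_homogeneousComponent Φ]; exact Finset.sum_eq_zero fun i _ => h i)
  have hhom := homogeneousComponent_isHomogeneous e Φ
  have : Nonempty (Fin (Module.finrank k (globalSections I d))) :=
    (Module.finBasis k (globalSections I d)).index_nonempty
  refine ⟨Proj.basicOpen _ (homogeneousComponent e Φ), nonempty_basicOpen hhom he,
    fun s hs hsU => ?_⟩
  obtain ⟨c, hc, hcΦ⟩ :=
    exists_eval_smul_ne_zero ((rationalPoint_mem_basicOpen_iff _ hhom).mp hsU)
  refine hsmul c s hc (H _ ?_)
  rwa [map_smul, Finsupp.coe_smul]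

end HoldsGenerically

section LocalBertini

open MvPolynomial IsLocalRing

variable {k : Type u} [Field k] {n : ℕ}

lemma isRegularLocalRing_localization_of_isRa {a : ℕ} {X : Scheme.{u}} (hX : IsRa a X)
    (W : X.affineOpens) (q : Ideal Γ(X, W.1)) [hq : q.IsPrime] (h : q.height ≤ a) :
    IsRegularLocalRing (Localization.AtPrime q) := by
  let x := W.2.fromSpec ⟨q, hq⟩
  have hx : x ∈ W.1 := W.2.range_fromSpec.le ⟨_, rfl⟩
  let := X.presheaf.algebra_section_stalk ⟨x, hx⟩
  have : IsLocalization.AtPrime (X.presheaf.stalk x) q := W.2.isLocalization_stalk' ⟨q, hq⟩ hx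
  have := hX x (by rw [IsLocalization.AtPrime.ringKrullDim_eq_height q]; exact_mod_cast h)
  exact IsRegularLocalRing.of_ringEquiv (IsLocalization.algEquiv q.primeCompl
    (X.presheaf.stalk x) (Localization.AtPrime q)).toRingEquiv

lemma adjoin_range_dehomHom_X (m : Fin (n + 1)) :
    letI := ((dehomHom k m).comp C).toAlgebra
    Algebra.adjoin k (Set.range fun j => dehomHom k m (X j)) = ⊤ := by
  let _ := ((dehomHom k m).comp C).toAlgebra
  let ψ : MvPolynomial (Fin (n + 1)) k →ₐ[k] Γ(PP n k, (chart k m).1) :=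
    { dehomHom k m with commutes' := fun _ => rfl }
  have h := congr(Subalgebra.map ψ $(adjoin_range_X (R := k) (σ := Fin (n + 1))))
  rwa [AlgHom.map_adjoin, ← Set.range_comp, Algebra.map_top,
    (AlgHom.range_eq_top ψ).mpr (dehomHom_surjective m)] at h

variable {X : Scheme.{u}} (f : X ⟶ PP n k) (m : Fin (n + 1)) (W : X.affineOpens)
  (hW : W.1 ≤ f ⁻¹ᵁ (chart k m).1)

/-- The `k`-algebra of functions on an affine open `W` of `X` that maps to the chart
`D₊(x_m)`. -/
noncomputable abbrev algebraSections : Algebra k Γ(X, W.1) :=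
  ((f.appLE (chart k m).1 W.1 hW).hom.comp ((dehomHom k m).comp C)).toAlgebra

lemma finiteType_sections [IsImmersion f] :
    letI := algebraSections f m W hW
    Algebra.FiniteType k Γ(X, W.1) := by
  have hC : (C : k →+* MvPolynomial (Fin (n + 1)) k).FiniteType :=
    RingHom.finiteType_algebraMap.mpr inferInstance
  exact (f.finiteType_appLE (chart k m).2 W.2 hW).comp
    (hC.comp_surjective (dehomHom_surjective m))

lemma appLE_dehom_sum {ι : Type*} [Fintype ι] {d : ℕ} (v : ι → k)
    (s : ι → homogeneousSubmodule (Fin (n + 1)) k d) :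
    letI := algebraSections f m W hW
    (f.appLE (chart k m).1 W.1 hW).hom (dehom (∑ j, v j • s j) m) =
      ∑ j, v j • (f.appLE (chart k m).1 W.1 hW).hom (dehom (s j) m) := by
  simp only [dehom_eq_dehomHom, Submodule.coe_sum, Submodule.coe_smul, smul_eq_C_mul, map_sum,
    map_mul]
  rfl

variable {I : (PP n k).IdealSheafData} {d : ℕ}

lemma appLE_dehom_eq_sum_repr {ι : Type*} [Fintype ι] (b : Module.Basis ι k (globalSections I d))
    (s : globalSections I d) :
    letI := algebraSections f m W hW
    (f.appLE (chart k m).1 W.1 hW).hom (dehom s.1 m) =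
      ∑ j, b.repr s j • (f.appLE (chart k m).1 W.1 hW).hom (dehom (b j).1 m) := by
  rw [← appLE_dehom_sum]
  conv_lhs => rw [← b.sum_repr s]
  rw [Submodule.coe_sum]
  rfl

lemma separatesJets_appLE_dehom [IsImmersion f] {ι : Type*} [Finite ι]
    (b : Module.Basis ι k (globalSections I d)) {e : ℕ}
    {g : homogeneousSubmodule (Fin (n + 1)) k e} (hg : g ∈ globalSections I e)
    (hu : IsUnit ((f.appLE (chart k m).1 W.1 hW).hom (dehom g m))) (hd : e < d) :
    letI := algebraSections f m W hW
    SeparatesJets k fun j => (f.appLE (chart k m).1 W.1 hW).hom (dehom (b j).1 m) := by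
  cases nonempty_fintype ι
  let φ := (f.appLE (chart k m).1 W.1 hW).hom
  let _ : Algebra k Γ(PP n k, (chart k m).1) := ((dehomHom k m).comp C).toAlgebra
  let _ : Algebra Γ(PP n k, (chart k m).1) Γ(X, W.1) := φ.toAlgebra
  let _ := algebraSections f m W hW
  have : IsScalarTower k Γ(PP n k, (chart k m).1) Γ(X, W.1) := .of_algebraMap_eq fun _ => rfl
  have : Algebra.FormallyUnramified Γ(PP n k, (chart k m).1) Γ(X, W.1) :=
    f.formallyUnramified_appLE (chart k m).2 W.2 hW
  -- The sections `g * X m ^ (d - e - 1) * X j` of `I(d)` dehomogenize to `g * X j`.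
  have hspan (j : Fin (n + 1)) : φ (dehom g m) * φ (dehomHom k m (.X j)) ∈
      Submodule.span k (Set.range fun j => φ (dehom (b j).1 m)) := by
    have hhom : (g.1 * (.X m ^ (d - e - 1) * .X j)).IsHomogeneous d := by
      convert IsHomogeneous.mul g.2 (((isHomogeneous_X k m).pow (d - e - 1)).mul
        (isHomogeneous_X k j)) using 1
      omega
    let s : globalSections I d := ⟨⟨_, hhom⟩, mem_globalSections_of_eq_mul hg rfl⟩
    have hs : dehom s.1 m = dehom g m * dehomHom k m (.X j) := by
      rw [dehom_eq_dehomHom, map_mul, map_mul, map_pow, dehomHom_X_self, one_pow, one_mul,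
        ← dehom_eq_dehomHom]
    rw [← map_mul, ← hs, appLE_dehom_eq_sum_repr f m W hW b]
    exact sum_mem fun i _ => Submodule.smul_mem _ _ (Submodule.subset_span ⟨i, rfl⟩)
  refine separatesJets_of_mul_mem_span (adjoin_range_dehomHom_X m) hu ?_ hspan
  simpa only [dehomHom_X_self, map_one, mul_one] using hspan m

/-- The local rings of `Y` of dimension at most `a` are regular at the points lying over the subset
`S` of `X`, so that `IsRaOver a p Set.univ` means `IsRa a Y`. -/
def IsRaOver (a : ℕ) {X Y : Scheme.{u}} (p : Y ⟶ X) (S : Set X) : Prop :=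
  ∀ y : Y, p y ∈ S → ringKrullDim (Y.presheaf.stalk y) ≤ a →
    IsRegularLocalRing (Y.presheaf.stalk y)

lemma holdsGenerically_isRaOver_interHypersurfaceι [IsImmersion f] {a : ℕ}
    (hX : IsRa a X) {e : ℕ} {g : homogeneousSubmodule (Fin (n + 1)) k e}
    (hg : g ∈ globalSections I e) (hu : IsUnit ((f.appLE (chart k m).1 W.1 hW).hom (dehom g m)))
    (hd : e < d) : HoldsGenerically k fun s : globalSections I d =>
      IsRaOver a (interHypersurfaceι f s.1) W.1 := by
  let _ := algebraSections f m W hW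
  let b := Module.finBasis k (globalSections I d)
  have := finiteType_sections f m W hW
  obtain ⟨Φ, hΦ, H⟩ := exists_forall_isRegularLocalRing_quotient
    (separatesJets_appLE_dehom f m W hW b hg hu hd) a
    fun q _ hq => isRegularLocalRing_localization_of_isRa hX W q hq
  refine ⟨Φ, hΦ, fun s hs y hy hdim => ?_⟩
  let x := interHypersurfaceι f s.1 y
  let := X.presheaf.algebra_section_stalk ⟨x, hy⟩
  let q := (W.2.primeIdealOf ⟨x, hy⟩).asIdeal
  have : IsLocalization.AtPrime (X.presheaf.stalk x) q := W.2.isLocalization_stalk ⟨x, hy⟩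
  let σ := IsLocalization.algEquiv q.primeCompl (X.presheaf.stalk x) (Localization.AtPrime q)
  let t := (f.appLE (chart k m).1 W.1 hW).hom (dehom s.1 m)
  have ht : t ∈ q := (IsLocalization.AtPrime.to_map_mem_maximal_iff (X.presheaf.stalk x) q _).mp
    (germ_appLE_dehom_mem_maximalIdeal f s.1 m W hW y hy)
  let E := (Ideal.quotientEquiv (Ideal.span {algebraMap _ _ t}) (Ideal.span {algebraMap _ _ t})
    σ.symm.toRingEquiv (by rw [Ideal.map_span, Set.image_singleton]; simp)).trans
    (stalkInterHypersurfaceEquiv f s.1 m W hW y hy)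
  have := H (b.repr s) hs q (algebraMap _ _ t)
    (by rw [← appLE_dehom_eq_sum_repr f m W hW b s])
    ((IsLocalization.AtPrime.to_map_mem_maximal_iff _ q _).mpr ht)
    ((ringKrullDim_eq_of_ringEquiv E).trans_le hdim)
  exact IsRegularLocalRing.of_ringEquiv E

end LocalBertini

section Codim

open TopologicalSpace

instance isNoetherian_PP (n : ℕ) (k : Type u) [Field k] : IsNoetherian (PP n k) :=
  (isNoetherian_iff_of_finite_iSup_eq_top (S := chart k) iSup_chart).mpr fun i =>
    isNoetherianRing_of_surjective _ _ (dehomHom k i) (dehomHom_surjective i)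

lemma exists_specializes_of_mem_closure_range {Z X : Type*} [TopologicalSpace Z]
    [TopologicalSpace X] [NoetherianSpace Z] [QuasiSober Z] {j : Z → X} (hj : Continuous j) {x : X}
    (hx : x ∈ closure (Set.range j)) : ∃ z : Z, j z ⤳ x := by
  have hrange : Set.range j = ⋃ C ∈ irreducibleComponents Z, j '' C := by
    rw [← Set.image_univ, ← sUnion_irreducibleComponents, Set.sUnion_eq_biUnion,
      Set.image_iUnion₂]
  rw [hrange, NoetherianSpace.finite_irreducibleComponents.closure_biUnion] at hx
  obtain ⟨C, hC, hx⟩ := Set.mem_iUnion₂.mp hx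
  refine ⟨hC.1.genericPoint,
    specializes_iff_mem_closure.mpr (closure_minimal ?_ isClosed_closure hx)⟩
  rintro _ ⟨z, hz, rfl⟩
  refine specializes_iff_mem_closure.mp (Specializes.map ?_ hj)
  rwa [specializes_iff_mem_closure,
    hC.1.closure_genericPoint (isClosed_of_mem_irreducibleComponents C hC)]

lemma exists_coheight_eq_zero (X : Scheme.{u}) [Nonempty X] : ∃ x : X, Order.coheight x = 0 := by
  obtain ⟨x⟩ := ‹Nonempty X›
  have hC := irreducibleComponent_mem_irreducibleComponents x
  refine ⟨hC.1.genericPoint, Order.coheight_eq_zero.mpr fun y hy => ?_⟩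
  have hg := hC.1.closure_genericPoint (isClosed_of_mem_irreducibleComponents _ hC)
  rw [Scheme.le_iff_specializes, specializes_iff_closure_subset] at hy ⊢
  rw [hg] at hy ⊢
  exact hC.2 isIrreducible_singleton.closure hy

lemma codim_le_coheight_of_mem_support_ker {Z X Y : Scheme.{u}} [IsNoetherian Y] (f : X ⟶ Y)
    [IsImmersion f] (j : Z ⟶ X) [IsImmersion j] {x : X} (hx : f x ∈ (j ≫ f).ker.support) :
    codim j ≤ Order.coheight x := by
  have : NoetherianSpace Z := (j ≫ f).isEmbedding.isInducing.noetherianSpace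
  have hfx : f x ∈ closure (Set.range (j ≫ f)) := by rwa [← Scheme.Hom.support_ker]
  have hx' : x ∈ closure (Set.range j) := by
    rw [f.isEmbedding.isInducing.closure_eq_preimage_closure_image, ← Set.range_comp]
    exact hfx
  obtain ⟨z, hz⟩ := exists_specializes_of_mem_closure_range j.continuous hx'
  exact (iInf_le _ z).trans (Order.coheight_anti (Scheme.le_iff_specializes.mpr hz))

variable {k : Type u} [Field k] {n : ℕ} {X Z : Scheme.{u}}

lemma exists_notMem_support_ker (f : X ⟶ PP n k) [IsImmersion f] (j : Z ⟶ X) [IsImmersion j]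
    (hZ : 0 < codim j) : ∃ x : PP n k, x ∉ (j ≫ f).ker.support := by
  rcases isEmpty_or_nonempty X with hX | hX
  · have : IsEmpty Z := Function.isEmpty j
    refine ⟨rationalPoint 1 one_ne_zero, ?_⟩
    rw [Scheme.ker_eq_top_of_isEmpty, Scheme.IdealSheafData.support_top]
    exact id
  · obtain ⟨x, hx⟩ := exists_coheight_eq_zero X
    exact ⟨f x, fun h => (hZ.trans_le (codim_le_coheight_of_mem_support_ker f j h)).ne' hx⟩

end Codim

section Bertini

open MvPolynomial

variable {k : Type u} [Field k] {n : ℕ} {X : Scheme.{u}}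

lemma coheight_le_ringKrullDim_stalk_interHypersurface_add_one [IsLocallyNoetherian X]
    (f : X ⟶ PP n k) {d : ℕ} (s : homogeneousSubmodule (Fin (n + 1)) k d)
    (y : (interHypersurface f s : Scheme.{u})) :
    (Order.coheight (interHypersurfaceι f s y) : WithBot ℕ∞) ≤
      ringKrullDim ((interHypersurface f s).presheaf.stalk y) + 1 := by
  obtain ⟨m, hm⟩ := exists_mem_chart (f (interHypersurfaceι f s y))
  obtain ⟨W, hW, hyW, hWm⟩ := exists_isAffineOpen_mem_and_subset (U := f ⁻¹ᵁ (chart k m).1) hm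
  rw [← ringKrullDim_stalk_eq_coheight, ← ringKrullDim_eq_of_ringEquiv
    (stalkInterHypersurfaceEquiv f s m ⟨W, hW⟩ hWm y hyW)]
  exact ringKrullDim_le_ringKrullDim_quotient_span_singleton_add_one
    (germ_appLE_dehom_mem_maximalIdeal f s m ⟨W, hW⟩ hWm y hyW)

lemma hypersurfaceIdeal_smul {d : ℕ} (s : homogeneousSubmodule (Fin (n + 1)) k d) {c : k}
    (hc : c ≠ 0) : hypersurfaceIdeal (c • s) = hypersurfaceIdeal s :=
  congrArg sInf (Set.ext fun J => (globalSections J d).smul_mem_iff hc)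

lemma interHypersurface_smul (f : X ⟶ PP n k) {d : ℕ}
    (s : homogeneousSubmodule (Fin (n + 1)) k d) {c : k} (hc : c ≠ 0) :
    interHypersurface f (c • s) = interHypersurface f s :=
  congrArg (fun J : (PP n k).IdealSheafData => pullback f J.subschemeι)
    (hypersurfaceIdeal_smul s hc)

variable {I : (PP n k).IdealSheafData}

lemma exists_forall_nontrivial_globalSections (hI : ∃ p : PP n k, p ∉ I.support) :
    ∃ e, ∀ d, e ≤ d → Nontrivial (globalSections I d) := by
  obtain ⟨p, hp⟩ := hI
  obtain ⟨m, e, g, hg, hpg⟩ := exists_globalSections_mem_basicOpen I p hp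
  have hg₀ : g.1 ≠ 0 := fun h => by
    rw [dehom_eq_dehomHom, h, map_zero, Scheme.basicOpen_zero] at hpg
    exact hpg
  refine ⟨e, fun d hd => ?_⟩
  have hhom : (g.1 * .X m ^ (d - e)).IsHomogeneous d := by
    convert IsHomogeneous.mul g.2 ((isHomogeneous_X k m).pow (d - e)) using 1
    omega
  exact ⟨⟨⟨_, hhom⟩, mem_globalSections_of_eq_mul hg rfl⟩, 0, fun h =>
    mul_ne_zero hg₀ (pow_ne_zero _ (X_ne_zero m)) congr(($h).1.1)⟩

lemma exists_affine_isUnit_appLE (f : X ⟶ PP n k) {x : X} (hx : f x ∉ I.support) :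
    ∃ (m : Fin (n + 1)) (e : ℕ) (g : homogeneousSubmodule (Fin (n + 1)) k e) (W : X.affineOpens)
      (hW : W.1 ≤ f ⁻¹ᵁ (chart k m).1), g ∈ globalSections I e ∧ x ∈ W.1 ∧
      IsUnit ((f.appLE (chart k m).1 W.1 hW).hom (dehom g m)) := by
  obtain ⟨m, e, g, hg, hxg⟩ := exists_globalSections_mem_basicOpen I (f x) hx
  obtain ⟨W, hW, hxW, hWg⟩ := exists_isAffineOpen_mem_and_subset
    (U := f ⁻¹ᵁ (PP n k).basicOpen (dehom g m)) hxg
  refine ⟨m, e, g, ⟨W, hW⟩, fun y hy => (PP n k).basicOpen_le _ (hWg hy), hg, hxW, ?_⟩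
  rw [← f.map_appLE hWg (homOfLE ((PP n k).basicOpen_le (dehom g m))).op]
  exact ((PP n k).toRingedSpace.isUnit_res_basicOpen (dehom g m)).map (f.appLE _ W hWg).hom

lemma exists_forall_holdsGenerically_isRaOver (f : X ⟶ PP n k) [IsImmersion f] {a : ℕ}
    (hX : IsRa a X) (I : (PP n k).IdealSheafData) :
    ∃ e, ∀ d, e < d → HoldsGenerically k fun s : globalSections I d =>
      IsRaOver a (interHypersurfaceι f s.1) (f ⁻¹' I.support)ᶜ := by
  have : TopologicalSpace.NoetherianSpace X := f.isEmbedding.isInducing.noetherianSpace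
  refine (TopologicalSpace.NoetherianSpace.isCompact (f ⁻¹' I.support)ᶜ).induction_on
    (p := fun S => ∃ e, ∀ d, e < d → HoldsGenerically k fun s : globalSections I d =>
      IsRaOver a (interHypersurfaceι f s.1) S) ?_ ?_ ?_ ?_
  · exact ⟨0, fun d _ => .of_forall fun s y hy => hy.elim⟩
  · rintro S T hST ⟨e, he⟩
    exact ⟨e, fun d hd => (he d hd).mono fun s hs y hy => hs y (hST hy)⟩
  · rintro S T ⟨e, he⟩ ⟨e', he'⟩
    refine ⟨max e e', fun d hd => ((he d ((le_max_left _ _).trans_lt hd)).and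
      (he' d ((le_max_right _ _).trans_lt hd))).mono fun s hs y hy => ?_⟩
    exact hy.elim (hs.1 y) (hs.2 y)
  · intro x hx
    obtain ⟨m, e, g, W, hW, hg, hxW, hu⟩ := exists_affine_isUnit_appLE f hx
    exact ⟨W.1, mem_nhdsWithin_of_mem_nhds (W.1.isOpen.mem_nhds hxW), e, fun d hd =>
      holdsGenerically_isRaOver_interHypersurfaceι f m W hW hX hg hu hd⟩

lemma isRa_interHypersurface_of_isRaOver {Z : Scheme.{u}} (f : X ⟶ PP n k) [IsImmersion f]
    (j : Z ⟶ X) [IsImmersion j] {a : ℕ} (hZ : (a : ℕ∞) + 1 < codim j) {d : ℕ}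
    {s : homogeneousSubmodule (Fin (n + 1)) k d}
    (hs : IsRaOver a (interHypersurfaceι f s) (f ⁻¹' (j ≫ f).ker.support)ᶜ) :
    IsRa a (interHypersurface f s) := by
  have : IsLocallyNoetherian X := LocallyOfFiniteType.isLocallyNoetherian f
  refine fun y hy => hs y (fun hyZ => ?_) hy
  refine (hZ.trans_le (codim_le_coheight_of_mem_support_ker f j hyZ)).not_ge ?_
  exact WithBot.coe_le_coe.mp
    ((coheight_le_ringKrullDim_stalk_interHypersurface_add_one f s y).trans
      (add_le_add_left hy 1))

end Bertini

end RaBertini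

/-- `i : X ⟶ ℙⁿ_k` and `j : Z ⟶ X` are the given subschemes; `(j ≫ i).ker` is the ideal sheaf of the
scheme-theoretic closure of `Z` in `ℙⁿ_k`. -/
theorem mainTheorem6 {k : Type u} [Field k] [Infinite k] (n a : ℕ) {X Z : Scheme.{u}}
    (i : X ⟶ RaBertini.PP n k) [IsImmersion i] (j : Z ⟶ X) [IsImmersion j]
    (hX : RaBertini.IsRa a X) (hZ : (a : ℕ∞) + 1 < RaBertini.codim j) :
    RaBertini.GeneralHypersurface (j ≫ i).ker i (RaBertini.IsRa a) := by
  obtain ⟨d₁, hd₁⟩ := RaBertini.exists_forall_nontrivial_globalSections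
    (RaBertini.exists_notMem_support_ker i j (zero_le.trans_lt hZ))
  obtain ⟨d₂, hd₂⟩ := RaBertini.exists_forall_holdsGenerically_isRaOver i hX (j ≫ i).ker
  refine ⟨max d₁ (d₂ + 1), fun d hd => ?_⟩
  have := hd₁ d (le_of_max_le_left hd)
  have hgen : RaBertini.HoldsGenerically k fun s : RaBertini.globalSections (j ≫ i).ker d =>
      RaBertini.IsRa a (RaBertini.interHypersurface i s.1) :=
    (hd₂ d (le_of_max_le_right hd)).mono fun _ =>
      RaBertini.isRa_interHypersurface_of_isRaOver i j hZ
  refine hgen.exists_linearSystem_opens fun c s hc hcs => ?_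
  rwa [Submodule.coe_smul, RaBertini.interHypersurface_smul _ _ hc] at hcs
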